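/- **Proposition 4.** Let $X=(X_t)_{t\ge 0}$ be a real stochastic process on a probability space $(\Omega,\mathcal F,\mathbb P)$ satisfying (LLN) below. For each $n$ let $Z_{j/n}=\mu+X_{j/n}+u_j$, $j=1,\dots,n$, where $\mu\in\mathbb R$ is a constant and $u_1,\dots,u_n$ are iid $N(0,\sigma_u^2)$ with $\sigma_u^2>0$ (the noise may depend on $n$, and no relation between the noise and $X$ is needed). Fix $p>0$ and an integer $m\ge 2$. Put $$\hat\gamma_p(k/n;Z)=\frac1{n-k}\sum_{i=1}^{n-k}\bigl|Z_{(i+k)/n}-Z_{i/n}\bigr|^p,\qquad x_{m,k}=\log k-\frac1m\sum_{l=1}^m\log l,$$ $$\hat a_{OLS}=\frac{\sum_{k=1}^m x_{m,k}\log\hat\gamma_p(k/n;Z)}{\sum_{k=1}^m x_{m,k}^2},\qquad \hat\alpha=\frac{\hat a_{OLS}}p-\frac12 .$$ Then $\hat\alpha\to-\tfrac12$ in $\mathbb P$-probability as $n\to\infty$. *Definitions.* A function $L$ is slowly varying at zero if $L(tx)/L(x)\to1$ as $x\downarrow0$ for every $t>0$. For $\alpha\in(-\frac12,\frac12)$,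 a process $Y=(Y_t)_{t\ge0}$ satisfies (A1)–(A3) with index $\alpha$ if $\gamma(h)=\mathbb E|Y_{t+h}-Y_t|^2$ is finite and does not depend on $t$, and: - (A1) $\gamma(x)=x^{2\alpha+1}L(x)$ for $x>0$, where $L:(0,\infty)\to[0,\infty)$ is continuously differentiable, bounded away from zero near $0$, and slowly varying at zero; - (A2) for $x>0$, $\gamma''(x)=x^{2\alpha-1}L_2(x)$ or, if $\alpha=0$, more generally $\gamma''(x)=f(x)L_2(x)$ with $|f(x)|\le Cx^{-\beta}$ for some $C>0$, $\beta>\frac12$; here $L_2$ is continuous on $(0,\infty)$ and slowly varying at zero; - (A3) $\limsup_{x\downarrow0}\sup_{y\in[x,x^b]}|L_2(y)/L(x)|<\infty$ for some $b\in(0,1)$. *(LLN)*: for some $\alpha\in(-\frac12,\frac12)$ one of the following holds. - (a) $X$ is a zero-mean Gaussian process with stationary increments that satisfies (A1)–(A3) with index $\alpha$. - (b) $X_t=X_0+\int_0^t\sigma_s\,dG_s$, $t\ge0$, as a pathwise Riemann–Stieltjes integral, where $G$ is as in (a) and the paths of $\sigma$ almost surely have finite $q$-variation on compact intervals for some $q\in\bigl(0,\frac1{1/2-\alpha}\bigr)$.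 - (c) $X_t=\int_{-\infty}^t g(t-s)\sigma_s\,dW_s$, $t\ge0$ (Itô integral), where $W$ is a two-sided Brownian motion with respect to a filtration $(\mathcal F_t)_{t\in\mathbb R}$ and $\sigma=(\sigma_t)_{t\in\mathbb R}$ is a stationary, jointly measurable, adapted process whose paths are almost surely locally bounded. Moreover $X$ satisfies (A1)–(A3) with index $\alpha$; $g$ is Borel with $\int_{-\infty}^t g(t-s)^2\sigma_s^2\,ds<\infty$ almost surely for every $t\ge 0$; for $x>0$, $g(x)=x^{\alpha}L_g(x)$ and $g'(x)=x^{\alpha-1}L_{g'}(x)$ (or, if $\alpha=0$, alternatively $g'(x)=L_{g'}(x)$) with $L_g,L_{g'}$ slowly varying at zero; $g'\in L^2((\varepsilon,\infty))$ for every $\varepsilon>0$; $|g'|$ is non-increasing on $(a,\infty)$ for some $a>0$; and $\int_1^\infty|g'(x)|^2\sigma_{t-x}^2\,dx<\infty$ almost surely for every $t>0$. -/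

import Mathlib

open MeasureTheory ProbabilityTheory Filter Topology Set
open scoped NNReal ENNReal

noncomputable section

namespace FractalIndex

/-! ### Variograms and the structural assumptions on them -/

/-- `L` is slowly varying at zero: `L (t x) / L x → 1` as `x ↓ 0`, for all `t > 0`. -/
def SlowlyVaryingAtZero (L : ℝ → ℝ) : Prop :=
  ∀ t : ℝ, 0 < t → Tendsto (fun x => L (t * x) / L x) (𝓝[>] 0) (𝓝 1)

/-- `γ` is a second order variogram with fractal index `α`.
`L` is the slowly varying factor of `γ` and `L₂` the slowly varying factor of `γ''`. -/
structure IsFractalVariogramWith (α : ℝ) (γ L L₂ : ℝ → ℝ) : Prop where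
  index_mem : α ∈ Ioo (-(1 / 2) : ℝ) (1 / 2)
  -- `γ(x) = x ^ (2 α + 1) L(x)`
  scaling : ∀ x, 0 < x → γ x = x ^ (2 * α + 1) * L x
  L_nonneg : ∀ x, 0 < x → 0 ≤ L x
  L_contDiff : ContDiffOn ℝ 1 L (Ioi 0)
  L_bounded_away : ∃ c, 0 < c ∧ ∀ᶠ x in 𝓝[>] (0 : ℝ), c ≤ L x
  L_slowlyVarying : SlowlyVaryingAtZero L
  -- `γ''(x) = x ^ (2 α - 1) L₂(x)`, or, in the case `α = 0`, `γ''(x) = f(x) L₂(x)` with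
  -- `|f(x)| ≤ C x ^ (-β)`, `β > 1/2`
  second_deriv : ∃ γ' f : ℝ → ℝ,
    (∀ x, 0 < x → HasDerivAt γ (γ' x) x ∧ HasDerivAt γ' (f x * L₂ x) x) ∧
    ((∀ x, 0 < x → f x = x ^ (2 * α - 1)) ∨
      (α = 0 ∧ ∃ C β : ℝ, 0 < C ∧ 1 / 2 < β ∧ ∀ x, 0 < x → |f x| ≤ C * x ^ (-β)))
  L₂_slowlyVarying : SlowlyVaryingAtZero L₂
  L₂_continuous : ContinuousOn L₂ (Ioi 0)
  -- `limsup_{x ↓ 0} sup_{y ∈ [x, x ^ b]} |L₂(y) / L(x)| < ∞` for some `b ∈ (0, 1)`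
  ratio_bounded : ∃ b ∈ Ioo (0 : ℝ) 1, ∃ C : ℝ, ∀ᶠ x in 𝓝[>] (0 : ℝ),
    ∀ y ∈ Icc x (x ^ b), |L₂ y / L x| ≤ C

/-- The structural assumptions on a second order variogram, for a fractal index `α`. -/
def IsFractalVariogram (α : ℝ) (γ : ℝ → ℝ) : Prop :=
  ∃ L L₂ : ℝ → ℝ, IsFractalVariogramWith α γ L L₂

/-! ### Processes -/

section Processes

variable {Ω : Type*} [mΩ : MeasurableSpace Ω]

/-- `γ` is the `p`-th order variogram of `X`: `γ(h) = E |X_{t+h} - X_t| ^ p` for all `t, h ≥ 0`;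
in particular these moments are finite and do not depend on `t`. -/
def HasVariogram (P : Measure Ω) (p : ℝ) (X : ℝ≥0 → Ω → ℝ) (γ : ℝ → ℝ) : Prop :=
  ∀ t h : ℝ≥0, Integrable (fun ω => |X (t + h) ω - X t ω| ^ p) P ∧
    ∫ ω, |X (t + h) ω - X t ω| ^ p ∂P = γ h

/-- The second order variogram of `X` satisfies the structural assumptions with index `α`. -/
def IsFractal (P : Measure Ω) (α : ℝ) (X : ℝ≥0 → Ω → ℝ) : Prop :=
  ∃ γ : ℝ → ℝ, HasVariogram P 2 X γ ∧ IsFractalVariogram α γ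

/-- The finite-dimensional laws of `t ↦ X_{t+h} - X_h` do not depend on `h`. -/
def HasStationaryIncrements (P : Measure Ω) (X : ℝ≥0 → Ω → ℝ) : Prop :=
  ∀ (h : ℝ≥0) (I : Finset ℝ≥0),
    IdentDistrib (fun ω (t : I) => X (t + h) ω - X h ω) (fun ω (t : I) => X t ω - X 0 ω) P P

/-- Strict stationarity of a process indexed by the real line. -/
def IsStationary (P : Measure Ω) (σ : ℝ → Ω → ℝ) : Prop :=
  ∀ (h : ℝ) (I : Finset ℝ),
    IdentDistrib (fun ω (t : I) => σ (t + h) ω) (fun ω (t : I) => σ t ω) P P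

/-- A zero-mean Gaussian process with stationary increments whose second order variogram satisfies
the structural assumptions with index `α`. -/
structure IsGaussianFractal (P : Measure Ω) (α : ℝ) (X : ℝ≥0 → Ω → ℝ) : Prop where
  gaussian : IsGaussianProcess X P
  zero_mean : ∀ t, ∫ ω, X t ω ∂P = 0
  stationary_increments : HasStationaryIncrements P X
  fractal : IsFractal P α X

/-! ### Pathwise integrals of volatility against a Gaussian process -/

/-- `f` has finite `q`-variation on every interval `[0, T]`. -/
def FiniteVariation (q : ℝ) (f : ℝ≥0 → ℝ) : Prop :=
  ∀ T : ℝ≥0, ∃ C : ℝ, ∀ (n : ℕ) (τ : ℕ → ℝ≥0), Monotone τ → (∀ i, τ i ≤ T) →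
    ∑ i ∈ Finset.range n, |f (τ (i + 1)) - f (τ i)| ^ q ≤ C

/-- `I` is the Riemann-Stieltjes integral of `f` against `g` over `[0, t]`: the limit of the
Riemann sums with arbitrary tags as the mesh of the partition tends to zero. -/
def IsRSIntegral (f g : ℝ≥0 → ℝ) (t : ℝ≥0) (I : ℝ) : Prop :=
  ∀ ε : ℝ, 0 < ε → ∃ δ : ℝ, 0 < δ ∧ ∀ (n : ℕ) (τ ξ : ℕ → ℝ≥0),
    Monotone τ → τ 0 = 0 → τ n = t →
    (∀ i < n, (τ (i + 1) : ℝ) - τ i < δ) → (∀ i < n, ξ i ∈ Icc (τ i) (τ (i + 1))) →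
    |∑ i ∈ Finset.range n, f (ξ i) * (g (τ (i + 1)) - g (τ i)) - I| < ε

/-- `X_t = X_0 + ∫_0^t σ_s dG_s`, with `G` a Gaussian fractal process of index `α` and `σ` of finite
`q`-variation for some `q < 1 / (1/2 - α)`; the integral is a pathwise Riemann-Stieltjes one. -/
def IsStochasticVolatility (P : Measure Ω) (α : ℝ) (X : ℝ≥0 → Ω → ℝ) : Prop :=
  ∃ G σ : ℝ≥0 → Ω → ℝ, IsGaussianFractal P α G ∧
    (∀ t, AEMeasurable (σ t) P) ∧
    (∃ q : ℝ, 0 < q ∧ q < 1 / (1 / 2 - α) ∧ ∀ᵐ ω ∂P, FiniteVariation q (fun t => σ t ω)) ∧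
    ∀ᵐ ω ∂P, ∀ t : ℝ≥0, IsRSIntegral (fun s => σ s ω) (fun s => G s ω) t (X t ω - X 0 ω)

/-! ### Brownian motion on the line and the Itô integral -/

/-- `W` is a two-sided Brownian motion for the filtration `𝓕`. Its increments are adapted; `W` itself
is not, as `W_s = -(W_0 - W_s)` is independent of `𝓕_s` for `s < 0`. -/
structure IsBrownianMotion (P : Measure Ω) (𝓕 : Filtration ℝ mΩ) (W : ℝ → Ω → ℝ) : Prop where
  zero : ∀ᵐ ω ∂P, W 0 ω = 0
  measurable : ∀ t, Measurable (W t)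
  continuous : ∀ᵐ ω ∂P, Continuous (fun t => W t ω)
  adapted : ∀ r s t : ℝ, r ≤ s → s ≤ t → Measurable[𝓕 t] (fun ω => W s ω - W r ω)
  indep : ∀ s t : ℝ, s ≤ t →
    Indep (𝓕 s) (MeasurableSpace.comap (fun ω => W t ω - W s ω) inferInstance) P
  law : ∀ s t : ℝ, s ≤ t → HasLaw (fun ω => W t ω - W s ω) (gaussianReal 0 (t - s).toNNReal) P

/-- A simple predictable process `∑_{j < n} ξ_j 1_{(t_j, t_{j+1}]}` on the real line, each `ξ_j`
being bounded and `𝓕_{t_j}`-measurable. -/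
structure SimpleProcess (𝓕 : Filtration ℝ mΩ) where
  n : ℕ
  time : ℕ → ℝ
  time_mono : Monotone time
  coeff : ℕ → Ω → ℝ
  coeff_measurable : ∀ j, Measurable[𝓕 (time j)] (coeff j)
  coeff_bounded : ∀ j, ∃ C : ℝ, ∀ ω, |coeff j ω| ≤ C

/-- The value of a simple process. -/
def SimpleProcess.val {𝓕 : Filtration ℝ mΩ} (H : SimpleProcess 𝓕) (s : ℝ) (ω : Ω) : ℝ :=
  ∑ j ∈ Finset.range H.n, (Ioc (H.time j) (H.time (j + 1))).indicator (fun _ => H.coeff j ω) s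

/-- The integral of a simple process over the real line against `W`. -/
def SimpleProcess.integral {𝓕 : Filtration ℝ mΩ} (H : SimpleProcess 𝓕) (W : ℝ → Ω → ℝ)
    (ω : Ω) : ℝ :=
  ∑ j ∈ Finset.range H.n, H.coeff j ω * (W (H.time (j + 1)) ω - W (H.time j) ω)

/-- `Y` is (a version of) the Itô integral `∫_ℝ H_s dW_s`: there are simple processes `Hⁿ` with
`∫_ℝ (Hⁿ_s - H_s)² ds → 0` and `∫_ℝ Hⁿ_s dW_s → Y` in probability. -/
def IsItoIntegral (P : Measure Ω) (𝓕 : Filtration ℝ mΩ) (W : ℝ → Ω → ℝ) (H : ℝ → Ω → ℝ)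
    (Y : Ω → ℝ) : Prop :=
  ∃ S : ℕ → SimpleProcess 𝓕,
    (∀ ε : ℝ≥0∞, 0 < ε →
      Tendsto (fun n => P {ω | ε ≤ ∫⁻ s, ‖(S n).val s ω - H s ω‖ₑ ^ 2}) atTop (𝓝 0)) ∧
    TendstoInMeasure P (fun n => (S n).integral W) atTop Y

/-- The assumptions on the kernel `g` of a Brownian semistationary process with volatility `σ`. -/
structure IsBSSKernel (P : Measure Ω) (α : ℝ) (g : ℝ → ℝ) (σ : ℝ → Ω → ℝ) : Prop where
  measurable : Measurable g
  -- `g(x) = x ^ α L_g(x)`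
  scaling : ∃ Lg : ℝ → ℝ, SlowlyVaryingAtZero Lg ∧ ∀ x, 0 < x → g x = x ^ α * Lg x
  -- `g'(x) = x ^ (α - 1) L_{g'}(x)`, or, in the case `α = 0`, `g'(x) = L_{g'}(x)`;
  -- `g' ∈ L²((ε, ∞))` for all `ε > 0`, and `|g'|` is non-increasing on some `(a, ∞)`;
  -- `∫_1^∞ |g'(x)|² σ_{t-x}² dx < ∞` for all `t > 0`
  deriv : ∃ g' Lg' : ℝ → ℝ, (∀ x, 0 < x → HasDerivAt g (g' x) x) ∧ SlowlyVaryingAtZero Lg' ∧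
    ((∀ x, 0 < x → g' x = x ^ (α - 1) * Lg' x) ∨ (α = 0 ∧ ∀ x, 0 < x → g' x = Lg' x)) ∧
    (∀ ε : ℝ, 0 < ε → MemLp g' 2 (volume.restrict (Ioi ε))) ∧
    (∃ a : ℝ, 0 < a ∧ AntitoneOn (fun x => |g' x|) (Ioi a)) ∧
    (∀ t : ℝ, 0 < t → ∀ᵐ ω ∂P, ∫⁻ x in Ioi (1 : ℝ), ‖g' x * σ (t - x) ω‖ₑ ^ 2 < ∞)

/-- `X_t = ∫_{-∞}^t g(t-s) σ_s dW_s`, `t ≥ 0`, is a Brownian semistationary process with fractal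
index `α`; `σ` is a stationary, measurable, adapted process with locally bounded paths. -/
def IsBSS (P : Measure Ω) (α : ℝ) (X : ℝ≥0 → Ω → ℝ) : Prop :=
  ∃ (𝓕 : Filtration ℝ mΩ) (W σ : ℝ → Ω → ℝ) (g : ℝ → ℝ),
    IsBrownianMotion P 𝓕 W ∧
    (∀ s, Measurable[𝓕 s] (σ s)) ∧ Measurable (Function.uncurry σ) ∧ IsStationary P σ ∧
    (∀ᵐ ω ∂P, ∀ T : ℝ, ∃ M : ℝ, ∀ s ∈ Icc (-T) T, |σ s ω| ≤ M) ∧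
    IsBSSKernel P α g σ ∧
    (∀ t : ℝ≥0, ∀ᵐ ω ∂P, ∫⁻ s in Iio (t : ℝ), ‖g (t - s) * σ s ω‖ₑ ^ 2 < ∞) ∧
    (∀ t : ℝ≥0, IsItoIntegral P 𝓕 W
      (fun s ω => (Iio (t : ℝ)).indicator (fun s => g (t - s) * σ s ω) s) (X t)) ∧
    IsFractal P α X

/-- The assumption for laws of large numbers: for some `α ∈ (-1/2, 1/2)`, `X` is a Gaussian fractal
process, or a stochastic volatility process, or a Brownian semistationary process of index `α`. -/
def LLN (P : Measure Ω) (X : ℝ≥0 → Ω → ℝ) : Prop :=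
  ∃ α ∈ Ioo (-(1 / 2) : ℝ) (1 / 2),
    IsGaussianFractal P α X ∨ IsStochasticVolatility P α X ∨ IsBSS P α X

end Processes

/-! ### The estimator -/

/-- The empirical `p`-th order variogram at lag `k` of observations `z_1, …, z_n`. -/
def empVariogram (p : ℝ) (n k : ℕ) (z : ℕ → ℝ) : ℝ :=
  1 / ((n : ℝ) - k) * ∑ i ∈ Finset.Icc 1 (n - k), |z (i + k) - z i| ^ p

/-- The centred regressor `log k - (1/m) ∑_{l=1}^m log l`. -/
def regressor (m k : ℕ) : ℝ :=
  Real.log k - 1 / (m : ℝ) * ∑ l ∈ Finset.Icc 1 m, Real.log l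

/-- The OLS slope in the regression of the log empirical variogram on `log k`, `k = 1, …, m`. -/
def olsSlope (p : ℝ) (m n : ℕ) (z : ℕ → ℝ) : ℝ :=
  1 / (∑ k ∈ Finset.Icc 1 m, regressor m k ^ 2) *
    ∑ k ∈ Finset.Icc 1 m, regressor m k * Real.log (empVariogram p n k z)

/-- The OLS estimator of the fractal index from the observations `z_1, …, z_n`. -/
def olsIndex (p : ℝ) (m n : ℕ) (z : ℕ → ℝ) : ℝ :=
  olsSlope p m n z / p - 1 / 2

end FractalIndex

end

/-! At a fixed lag `k` the increments of `X` shrink as the sampling gets finer, while those of the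
noise do not. Every noise increment at a positive lag is `N(0, 2σ_u²)`, whatever the lag, and two
increments at the same lag are independent unless they share an index. Chebyshev's inequality
therefore gives the noise variogram a positive limit that does not depend on `k`
(`tendstoInMeasure_empVariogram_noise`). The variogram of `X` tends to zero
(`LLN.tendstoInMeasure_empVariogram`), and adding `X` does not change the limit
(`tendstoInMeasure_empVariogram_add`). So all `m` responses in the regression have the same limit.
The regressors sum to zero, hence the slope tends to zero and the index to `-1/2`
(`tendstoInMeasure_olsIndex`).

That the variogram of `X` vanishes is shown separately in each model. Second moments would not
control powers `p > 2`, so the Gaussian and the Brownian semistationary cases go through a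
sub-Gaussian criterion, `tendstoInMeasure_empVariogram_zero`. For a Gaussian process the variance
proxy is the variogram at `k/n`. For an Itô integral it is the random integral of the squared
integrand. The exponential bound then comes from exponential martingales of simple processes and
Fatou's lemma (`IsItoIntegral.setLIntegral_exp_le`), and the proxy tends to zero pathwise, uniformly
over increments, by `eventually_lintegral_movingIntegrand_sub_sq_le`. In the Riemann–Stieltjes case,
freezing the bounded integrand compares the increments of `X` pathwise with those of `G`, up to a
uniformly small error. -/

namespace FractalIndex

/-! ### Elementary analysis -/

/-- A continuous function that is slowly varying at zero grows slower than any power. -/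
theorem SlowlyVaryingAtZero.exists_bound {L : ℝ → ℝ} (hL : SlowlyVaryingAtZero L)
    (hc : ContinuousOn L (Ioi 0)) {ε : ℝ} (hε : 0 < ε) :
    ∃ C δ : ℝ, 0 < C ∧ 0 < δ ∧ ∀ x ∈ Ioc 0 δ, |L x| ≤ C * x ^ (-ε) := by
  -- As `0 / 0 = 0`, the ratio at `t = 1` tends to one only if `L` is eventually nonzero.
  have h1 := hL 1 one_pos
  have h2 := (hL (1 / 2) (by norm_num)).abs
  have e1 : ∀ᶠ x in 𝓝[>] (0 : ℝ), L x ≠ 0 := by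
    filter_upwards [h1.eventually_ne one_ne_zero] with x hx h0
    simp [h0] at hx
  have e2 : ∀ᶠ x in 𝓝[>] (0 : ℝ), |L (1 / 2 * x) / L x| < 2 ^ ε := by
    refine h2.eventually_lt_const ?_
    rw [abs_one]
    exact Real.one_lt_rpow (by norm_num) hε
  obtain ⟨δ', hδ', hδ⟩ := mem_nhdsGT_iff_exists_Ioc_subset.1 (e1.and e2)
  have hδ'0 : 0 < δ' := hδ'
  -- Halving `x` does not increase `|L x| * x ^ ε`, so its bound on the block `[δ'/2, δ']`, where it
  -- is continuous, propagates to all smaller dyadic blocks.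
  have step : ∀ x ∈ Ioc 0 δ', |L (x / 2)| * (x / 2) ^ ε ≤ |L x| * x ^ ε := by
    intro x hx
    obtain ⟨hx0, hx1⟩ := hδ hx
    rw [abs_div, div_lt_iff₀ (abs_pos.2 hx0)] at hx1
    rw [Real.div_rpow hx.1.le (by norm_num)]
    have h2p : (0 : ℝ) < 2 ^ ε := by positivity
    have hxp : (0 : ℝ) ≤ x ^ ε := Real.rpow_nonneg hx.1.le _
    have : |L (x / 2)| ≤ 2 ^ ε * |L x| := by
      rw [show x / 2 = 1 / 2 * x by ring]; exact hx1.le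
    calc |L (x / 2)| * (x ^ ε / 2 ^ ε) ≤ 2 ^ ε * |L x| * (x ^ ε / 2 ^ ε) := by gcongr
      _ = |L x| * x ^ ε := by field_simp
  have hcont : ContinuousOn (fun x => |L x| * x ^ ε) (Icc (δ' / 2) δ') := by
    refine ContinuousOn.mul (hc.mono fun x hx => ?_).abs ?_
    · exact lt_of_lt_of_le (by positivity) hx.1
    · exact (Real.continuous_rpow_const hε.le).continuousOn
  obtain ⟨M, hM⟩ := isCompact_Icc.exists_bound_of_continuousOn hcont
  have key : ∀ j : ℕ, ∀ x ∈ Ioc 0 δ', δ' / 2 ^ (j + 1) < x → |L x| * x ^ ε ≤ M := by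
    intro j
    induction j with
    | zero =>
      intro x hx h
      refine (le_abs_self _).trans (hM x ⟨?_, hx.2⟩)
      simpa using h.le
    | succ j ih =>
      intro x hx h
      by_cases h' : x ≤ δ' / 2
      · have hm : 2 * x ∈ Ioc 0 δ' := ⟨by linarith [hx.1], by linarith⟩
        have := step (2 * x) hm
        rw [show 2 * x / 2 = x by ring] at this
        refine this.trans (ih _ hm ?_)
        rw [pow_succ, ← div_div, div_lt_iff₀ (by norm_num)] at h
        linarith
      · exact (le_abs_self _).trans (hM x ⟨(not_le.1 h').le, hx.2⟩)
  refine ⟨max M 1, δ', by positivity, hδ'0, fun x hx => ?_⟩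
  obtain ⟨j, hj⟩ := pow_unbounded_of_one_lt (δ' / x) (one_lt_two (α := ℝ))
  have hb := key j x hx (by
    rw [div_lt_iff₀ (by positivity)]
    rw [div_lt_iff₀ hx.1] at hj
    rw [pow_succ]
    nlinarith [hx.1, pow_pos (two_pos (α := ℝ)) j])
  rw [Real.rpow_neg hx.1.le, ← div_eq_mul_inv, le_div_iff₀ (Real.rpow_pos_of_pos hx.1 _)]
  exact hb.trans (le_max_left _ _)

/-- If `|a|` is small relative to `|b|`, homogeneity reduces the claim to continuity of `s ↦ |s + 1|
^ p` at zero; otherwise `|b|` is at most a multiple of `|a|` and both powers are absorbed by `C *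
|a| ^ p`. This treats `p < 1` and `p ≥ 1` alike. -/
theorem exists_abs_rpow_add_sub_le {p : ℝ} (hp : 0 < p) {ε : ℝ} (hε : 0 < ε) :
    ∃ C : ℝ, 0 < C ∧ ∀ a b : ℝ, |(|a + b| ^ p - |b| ^ p)| ≤ ε * |b| ^ p + C * |a| ^ p := by
  have hcont : Continuous fun s : ℝ => |s + 1| ^ p :=
    (by fun_prop : Continuous fun s : ℝ => |s + 1|).rpow_const fun _ => Or.inr hp.le
  obtain ⟨δ, hδ, h⟩ := Metric.continuous_iff.1 hcont 0 ε hε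
  have hC : 0 < (1 + 1 / δ) ^ p := by positivity
  refine ⟨(1 + 1 / δ) ^ p, hC, fun a b => ?_⟩
  by_cases hab : |a| < δ * |b|
  · have hb : b ≠ 0 := by
      rintro rfl
      simp at hab
      exact absurd hab (not_lt.2 (abs_nonneg a))
    have h1 := h (a / b) (by
      rw [dist_zero_right, Real.norm_eq_abs, abs_div, div_lt_iff₀ (abs_pos.2 hb)]
      exact hab)
    rw [Real.dist_eq] at h1
    have e : |a + b| ^ p - |b| ^ p = (|a / b + 1| ^ p - |0 + 1| ^ p) * |b| ^ p := by
      have : |a + b| = |a / b + 1| * |b| := by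
        rw [← abs_mul]; congr 1; field_simp
      rw [this, Real.mul_rpow (abs_nonneg _) (abs_nonneg _)]
      simp
      ring
    rw [e, abs_mul, abs_of_nonneg (Real.rpow_nonneg (abs_nonneg b) p)]
    have h2 : 0 ≤ |b| ^ p := by positivity
    have h3 : 0 ≤ (1 + 1 / δ) ^ p * |a| ^ p := by positivity
    nlinarith
  · rw [not_lt] at hab
    have hb : |b| ≤ 1 / δ * |a| := by
      rw [one_div, ← div_eq_inv_mul, le_div_iff₀ hδ]; linarith
    have h1 : |a + b| ^ p ≤ (1 + 1 / δ) ^ p * |a| ^ p := by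
      rw [← Real.mul_rpow (by positivity) (abs_nonneg _)]
      refine Real.rpow_le_rpow (abs_nonneg _) ?_ hp.le
      linarith [abs_add_le a b]
    have h2 : |b| ^ p ≤ (1 + 1 / δ) ^ p * |a| ^ p := by
      rw [← Real.mul_rpow (by positivity) (abs_nonneg _)]
      refine Real.rpow_le_rpow (abs_nonneg _) ?_ hp.le
      linarith [abs_nonneg a]
    have h3 : 0 ≤ |b| ^ p := by positivity
    have h4 : 0 ≤ |a + b| ^ p := by positivity
    rw [abs_le]
    constructor <;> nlinarith

theorem abs_add_rpow_le {p : ℝ} (hp : 0 < p) (a b : ℝ) :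
    |a + b| ^ p ≤ 2 ^ p * (|a| ^ p + |b| ^ p) := by
  have h1 : |a + b| ≤ 2 * max |a| |b| := by
    linarith [abs_add_le a b, le_max_left |a| |b|, le_max_right |a| |b|]
  have ha : 0 ≤ |a| ^ p := by positivity
  have hb : 0 ≤ |b| ^ p := by positivity
  calc |a + b| ^ p ≤ (2 * max |a| |b|) ^ p := Real.rpow_le_rpow (abs_nonneg _) h1 hp.le
    _ = 2 ^ p * (max |a| |b|) ^ p := Real.mul_rpow (by norm_num) (by positivity)
    _ ≤ 2 ^ p * (|a| ^ p + |b| ^ p) := by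
      gcongr
      rcases max_choice |a| |b| with h | h <;> rw [h] <;> linarith

/-- Obtained by raising `t ≤ exp t`, at `t = |y| / p`, to the power `p`; it turns exponential
moments into power moments. -/
theorem abs_rpow_le_exp_add_exp {p : ℝ} (hp : 0 < p) (y : ℝ) :
    |y| ^ p ≤ p ^ p * (Real.exp y + Real.exp (-y)) := by
  have h1 : |y| ≤ p * Real.exp (|y| / p) := by
    have := Real.add_one_le_exp (|y| / p)
    calc |y| = p * (|y| / p) := by field_simp
      _ ≤ p * Real.exp (|y| / p) := by gcongr; linarith
  calc |y| ^ p ≤ (p * Real.exp (|y| / p)) ^ p := Real.rpow_le_rpow (abs_nonneg _) h1 hp.le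
    _ = p ^ p * Real.exp |y| := by
      rw [Real.mul_rpow hp.le (Real.exp_pos _).le, ← Real.exp_mul]
      congr 2
      field_simp
    _ ≤ p ^ p * (Real.exp y + Real.exp (-y)) := by
      gcongr
      rcases abs_choice y with h | h <;> rw [h] <;>
        linarith [Real.exp_pos y, Real.exp_pos (-y)]

/-- Centring makes the slope blind to a constant common to all responses. -/
theorem sum_regressor {m : ℕ} (hm : m ≠ 0) : ∑ k ∈ Finset.Icc 1 m, regressor m k = 0 := by
  have : (m : ℝ) ≠ 0 := by exact_mod_cast hm
  simp only [regressor, Finset.sum_sub_distrib, Finset.sum_const, Nat.card_Icc,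
    Nat.add_sub_cancel, nsmul_eq_mul]
  field_simp
  ring

/-! ### The empirical variogram of the noise -/

section Noise

variable {Ω : Type*} [mΩ : MeasurableSpace Ω] {P : Measure Ω} [IsProbabilityMeasure P]

theorem covariance_le_half_add {X Y : Ω → ℝ} (hX : MemLp X 2 P) (hY : MemLp Y 2 P) :
    cov[X, Y; P] ≤ (Var[X; P] + Var[Y; P]) / 2 := by
  have h := variance_nonneg (X - Y) P
  rw [variance_sub hX hY] at h
  linarith

/-- Chebyshev's inequality for averages of variables which are uncorrelated unless their indices
differ by `0` or `k`. -/
theorem measure_average_sub_ge_le {N k : ℕ} (hN : 0 < N) {ξ : ℕ → Ω → ℝ} {μ V : ℝ}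
    (hL : ∀ i ∈ Finset.Icc 1 N, MemLp (ξ i) 2 P)
    (hmean : ∀ i ∈ Finset.Icc 1 N, ∫ ω, ξ i ω ∂P = μ)
    (hvar : ∀ i ∈ Finset.Icc 1 N, Var[ξ i; P] = V)
    (hcov : ∀ i ∈ Finset.Icc 1 N, ∀ j ∈ Finset.Icc 1 N, j ≠ i → j ≠ i + k → i ≠ j + k →
      cov[ξ i, ξ j; P] = 0) {δ : ℝ} (hδ : 0 < δ) :
    P {ω | δ ≤ |1 / (N : ℝ) * ∑ i ∈ Finset.Icc 1 N, ξ i ω - μ|} ≤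
      ENNReal.ofReal (3 * V / δ ^ 2 / N) := by
  have hN' : (0 : ℝ) < N := by exact_mod_cast hN
  have hV : 0 ≤ V := by
    rw [← hvar 1 (Finset.mem_Icc.2 ⟨le_rfl, hN⟩)]
    exact variance_nonneg _ _
  have hLs : MemLp (fun ω => ∑ i ∈ Finset.Icc 1 N, ξ i ω) 2 P := memLp_finsetSum _ hL
  have hm : ∫ ω, 1 / (N : ℝ) * ∑ i ∈ Finset.Icc 1 N, ξ i ω ∂P = μ := by
    rw [integral_const_mul,
      integral_finsetSum _ fun i hi => (hL i hi).integrable (by norm_num),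
      Finset.sum_congr rfl hmean]
    simp
    field_simp
  have hv : Var[fun ω => 1 / (N : ℝ) * ∑ i ∈ Finset.Icc 1 N, ξ i ω; P] ≤ 3 * V / N := by
    rw [variance_const_mul, variance_fun_sum' hL]
    -- A row of the covariance matrix has at most three nonzero entries, each at most `V`. The
    -- truncated `i - k` may be `0`, which lies outside the range of summation and contributes
    -- nothing.
    have hrow : ∀ i ∈ Finset.Icc 1 N, ∑ j ∈ Finset.Icc 1 N, cov[ξ i, ξ j; P] ≤ 3 * V := by
      intro i hi
      calc ∑ j ∈ Finset.Icc 1 N, cov[ξ i, ξ j; P]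
          ≤ ∑ j ∈ Finset.Icc 1 N, ((if j = i then V else 0) + (if j = i + k then V else 0)
              + (if j = i - k then V else 0)) := by
            refine Finset.sum_le_sum fun j hj => ?_
            have hle : cov[ξ i, ξ j; P] ≤ V := by
              have := covariance_le_half_add (hL i hi) (hL j hj)
              rw [hvar i hi, hvar j hj] at this
              linarith
            by_cases h1 : j = i
            · rw [if_pos h1]
              have : 0 ≤ (if j = i + k then V else 0) := by split_ifs <;> simp [hV]
              have : 0 ≤ (if j = i - k then V else 0) := by split_ifs <;> simp [hV]
              linarith
            by_cases h2 : j = i + k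
            · rw [if_pos h2, if_neg h1]
              have : 0 ≤ (if j = i - k then V else 0) := by split_ifs <;> simp [hV]
              linarith
            by_cases h3 : i = j + k
            · have h3' : j = i - k := by omega
              rw [if_neg h1, if_neg h2, if_pos h3']
              linarith
            rw [hcov i hi j hj h1 h2 h3, if_neg h1, if_neg h2]
            split_ifs <;> simp [hV]
        _ ≤ 3 * V := by
            rw [Finset.sum_add_distrib, Finset.sum_add_distrib, Finset.sum_ite_eq',
              Finset.sum_ite_eq', Finset.sum_ite_eq']
            split_ifs <;> linarith
    have hsum : ∑ i ∈ Finset.Icc 1 N, ∑ j ∈ Finset.Icc 1 N, cov[ξ i, ξ j; P] ≤ N * (3 * V) := by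
      refine (Finset.sum_le_sum hrow).trans_eq ?_
      simp
    calc (1 / (N : ℝ)) ^ 2 * ∑ i ∈ Finset.Icc 1 N, ∑ j ∈ Finset.Icc 1 N, cov[ξ i, ξ j; P]
        ≤ (1 / (N : ℝ)) ^ 2 * (N * (3 * V)) := by gcongr
      _ = 3 * V / N := by field_simp
  have hch := meas_ge_le_variance_div_sq (hLs.const_mul (1 / (N : ℝ))) hδ
  rw [hm] at hch
  refine hch.trans (ENNReal.ofReal_le_ofReal ?_)
  calc _ ≤ 3 * V / N / δ ^ 2 := by gcongr
    _ = _ := by field_simp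

theorem memLp_abs_rpow_gaussianReal {p : ℝ} (hp : 0 < p) (v : ℝ≥0) :
    MemLp (fun x : ℝ => |x| ^ p) 2 (gaussianReal 0 v) := by
  have h := (memLp_id_gaussianReal (μ := 0) (v := v) (2 * p.toNNReal)).norm_rpow_div
    (p.toNNReal : ℝ≥0∞)
  have hp' : (p.toNNReal : ℝ≥0∞) ≠ 0 := by simpa using hp
  convert! h using 1
  · ext x
    simp [hp.le]
  · push_cast
    rw [ENNReal.mul_div_cancel_right hp' ENNReal.coe_ne_top]

theorem integral_abs_rpow_gaussianReal_pos {p : ℝ} (hp : 0 < p) {v : ℝ≥0} (hv : v ≠ 0) :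
    0 < ∫ x, |x| ^ p ∂gaussianReal 0 v := by
  have hi := (memLp_abs_rpow_gaussianReal hp v).integrable (by norm_num)
  rw [integral_pos_iff_support_of_nonneg (fun x => by positivity) hi]
  have hs : Function.support (fun x : ℝ => |x| ^ p) = {0}ᶜ := by
    ext x
    simp [hp.ne']
  have := nullSingletonClass_gaussianReal (μ := 0) hv
  rw [hs, prob_compl_eq_one_sub (measurableSet_singleton _), measure_singleton]
  simp

/-- The law of large numbers for the empirical variogram of white noise. -/
theorem tendstoInMeasure_empVariogram_noise {v : ℝ≥0} {u : ℕ → ℕ → Ω → ℝ}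
    (hu_law : ∀ n, ∀ j ∈ Finset.Icc 1 n, HasLaw (u n j) (gaussianReal 0 v) P)
    (hu_indep : ∀ n, iIndepFun (fun j : Finset.Icc 1 n => u n j) P)
    {p : ℝ} (hp : 0 < p) {k : ℕ} (hk : 0 < k) :
    TendstoInMeasure P (fun n ω => empVariogram p n k (fun j => u n j ω)) atTop
      (fun _ => ∫ x, |x| ^ p ∂gaussianReal 0 (v + v)) := by
  set ν := gaussianReal 0 (v + v) with hν
  set V : ℝ := Var[fun x : ℝ => |x| ^ p; ν] with hVdef
  have hLν := memLp_abs_rpow_gaussianReal hp (v + v)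
  have hmeas : Measurable fun x : ℝ => |x| ^ p := by fun_prop
  rw [tendstoInMeasure_iff_norm]
  intro δ hδ
  have hmem : ∀ n i, i ∈ Finset.Icc 1 (n - k) → i ∈ Finset.Icc 1 n ∧ i + k ∈ Finset.Icc 1 n := by
    intro n i hi
    simp only [Finset.mem_Icc] at hi ⊢
    omega
  have hlaw : ∀ n, ∀ i ∈ Finset.Icc 1 (n - k),
      HasLaw (fun ω => u n (i + k) ω - u n i ω) ν P := by
    intro n i hi
    obtain ⟨h1, h2⟩ := hmem n i hi
    have hneg : HasLaw (-(u n i)) (gaussianReal 0 v) P := by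
      simpa using! gaussianReal_neg (hu_law n i h1)
    have hind : IndepFun (u n (i + k)) (-(u n i)) P := by
      have h := (hu_indep n).indepFun (i := ⟨i + k, h2⟩) (j := ⟨i, h1⟩)
        (by simp only [ne_eq, Subtype.mk.injEq]; omega)
      exact h.comp measurable_id measurable_neg
    have h := gaussianReal_add_gaussianReal_of_indepFun hind (hu_law n _ h2).map_eq hneg.map_eq
    rw [add_zero] at h
    refine ⟨((hu_law n _ h2).aemeasurable.sub (hu_law n _ h1).aemeasurable), ?_⟩
    rw [hν, ← h, ← sub_eq_add_neg]
    rfl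
  have hbound : ∀ n, k < n → P {ω | δ ≤ ‖empVariogram p n k (fun j => u n j ω)
      - ∫ x, |x| ^ p ∂ν‖} ≤ ENNReal.ofReal (3 * V / δ ^ 2 / (n - k : ℕ)) := by
    intro n hn
    have hN : 0 < n - k := by omega
    have hL : ∀ i ∈ Finset.Icc 1 (n - k),
        MemLp (fun ω => |u n (i + k) ω - u n i ω| ^ p) 2 P := by
      intro i hi
      have h := hlaw n i hi
      have := hLν
      rw [← hν, ← h.map_eq] at this
      exact (memLp_map_measure_iff (this.1) h.aemeasurable).1 this
    have := measure_average_sub_ge_le (P := P) (k := k) hN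
      (ξ := fun i ω => |u n (i + k) ω - u n i ω| ^ p)
      (μ := ∫ x, |x| ^ p ∂ν) (V := V) hL ?_ ?_ ?_ hδ
    · rw [Nat.cast_sub hn.le] at this ⊢
      exact this
    · intro i hi
      exact (hlaw n i hi).integral_comp hmeas.aestronglyMeasurable
    · intro i hi
      have h := hlaw n i hi
      rw [hVdef, ← h.map_eq, variance_map (h.map_eq ▸ hmeas.aemeasurable) h.aemeasurable]
      rfl
    · intro i hi j hj h1 h2 h3
      refine IndepFun.covariance_eq_zero ?_ (hL i hi) (hL j hj)
      obtain ⟨i1, i2⟩ := hmem n i hi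
      obtain ⟨j1, j2⟩ := hmem n j hj
      -- The index pairs `{i + k, i}` and `{j + k, j}` are disjoint here, so the two increments are
      -- independent.
      have h := (hu_indep n).indepFun_prodMk_prodMk₀ (fun a => (hu_law n a a.2).aemeasurable)
        ⟨i + k, i2⟩ ⟨i, i1⟩ ⟨j + k, j2⟩ ⟨j, j1⟩ (by simpa using Ne.symm h1) (by simpa using h2.symm)
        (by simpa using h3) (by simpa using Ne.symm h1)
      have hm : Measurable fun x : ℝ × ℝ => |x.1 - x.2| ^ p := by fun_prop
      exact h.comp hm hm
  have hlim : Tendsto (fun n : ℕ => ENNReal.ofReal (3 * V / δ ^ 2 / (n - k : ℕ))) atTop (𝓝 0) := by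
    rw [← ENNReal.ofReal_zero]
    refine ENNReal.tendsto_ofReal ?_
    exact (tendsto_const_div_atTop_nhds_zero_nat _).comp (tendsto_sub_atTop_nat k)
  refine tendsto_of_tendsto_of_tendsto_of_le_of_le' tendsto_const_nhds hlim
    (Eventually.of_forall fun _ => zero_le) ?_
  filter_upwards [eventually_gt_atTop k] with n hn using hbound n hn

end Noise

/-! ### From empirical variograms to the estimator -/

section Reduction

variable {Ω : Type*} [mΩ : MeasurableSpace Ω] {P : Measure Ω}

theorem empVariogram_nonneg {p : ℝ} {n k : ℕ} (hk : k ≤ n) (z : ℕ → ℝ) :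
    0 ≤ empVariogram p n k z := by
  have : (0 : ℝ) ≤ (n : ℝ) - k := sub_nonneg.2 (by exact_mod_cast hk)
  unfold empVariogram
  positivity

theorem abs_empVariogram_sub_le {p a b : ℝ} {n k : ℕ} (hk : k ≤ n)
    (h : ∀ s t : ℝ, |(|s + t| ^ p - |t| ^ p)| ≤ a * |t| ^ p + b * |s| ^ p) {x y z : ℕ → ℝ} {c : ℝ}
    (hz : ∀ j ∈ Finset.Icc 1 n, z j = c + x j + y j) :
    |empVariogram p n k z - empVariogram p n k y| ≤
      a * empVariogram p n k y + b * empVariogram p n k x := by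
  have hN : (0 : ℝ) ≤ 1 / ((n : ℝ) - k) :=
    one_div_nonneg.2 (sub_nonneg.2 (by exact_mod_cast hk))
  have hs : |∑ i ∈ Finset.Icc 1 (n - k), (|z (i + k) - z i| ^ p - |y (i + k) - y i| ^ p)| ≤
      ∑ i ∈ Finset.Icc 1 (n - k), (a * |y (i + k) - y i| ^ p + b * |x (i + k) - x i| ^ p) := by
    refine (Finset.abs_sum_le_sum_abs _ _).trans (Finset.sum_le_sum fun i hi => ?_)
    simp only [Finset.mem_Icc] at hi
    rw [hz i (Finset.mem_Icc.2 (by omega)), hz (i + k) (Finset.mem_Icc.2 (by omega)),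
      show c + x (i + k) + y (i + k) - (c + x i + y i) =
        (x (i + k) - x i) + (y (i + k) - y i) by ring]
    exact h _ _
  rw [Finset.sum_sub_distrib] at hs
  rw [Finset.sum_add_distrib, ← Finset.mul_sum, ← Finset.mul_sum] at hs
  unfold empVariogram
  rw [← mul_sub, abs_mul, abs_of_nonneg hN]
  refine (mul_le_mul_of_nonneg_left hs hN).trans_eq ?_
  ring

/-- Adding a process with negligible empirical variogram does not change the limit. -/
theorem tendstoInMeasure_empVariogram_add {p : ℝ} (hp : 0 < p) {k : ℕ} {γ c : ℝ}
    {x y z : ℕ → ℕ → Ω → ℝ}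
    (hz : ∀ n, ∀ j ∈ Finset.Icc 1 n, ∀ ω, z n j ω = c + x n j ω + y n j ω)
    (hx : TendstoInMeasure P (fun n ω => empVariogram p n k (fun j => x n j ω)) atTop
      (fun _ => 0))
    (hy : TendstoInMeasure P (fun n ω => empVariogram p n k (fun j => y n j ω)) atTop
      (fun _ => γ)) :
    TendstoInMeasure P (fun n ω => empVariogram p n k (fun j => z n j ω)) atTop (fun _ => γ) := by
  rw [tendstoInMeasure_iff_norm] at hx hy ⊢
  intro ε hε
  -- Once the variogram of `y` is within one of `γ`, it is at most `|γ| + 1`, and its coefficient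
  -- `ε'` costs at most `ε / 4`. The terms from `x` and from `y`'s own deviation cost `ε / 4` each.
  set ε' := ε / (4 * (|γ| + 1)) with hε'
  have hε'0 : 0 < ε' := by positivity
  obtain ⟨C, hC, hineq⟩ := exists_abs_rpow_add_sub_le hp hε'0
  have hd : 0 < min 1 (ε / 4) := by positivity
  have h1 := hx (ε / (4 * C)) (by positivity)
  have h2 := hy (min 1 (ε / 4)) hd
  have h12 := h1.add h2
  rw [add_zero] at h12
  refine tendsto_of_tendsto_of_tendsto_of_le_of_le' tendsto_const_nhds h12
    (Eventually.of_forall fun _ => zero_le) ?_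
  filter_upwards [eventually_ge_atTop k] with n hn
  refine (measure_mono ?_).trans (measure_union_le _ _)
  intro ω hω
  by_contra hcon
  simp only [mem_union, mem_ofPred_eq, not_or, not_le, Real.norm_eq_abs, sub_zero] at hcon hω
  obtain ⟨hA, hB⟩ := hcon
  have hB1 := hB.trans_le (min_le_left _ _)
  have hB2 := hB.trans_le (min_le_right _ _)
  have key := abs_empVariogram_sub_le (z := fun j => z n j ω) (x := fun j => x n j ω)
    (y := fun j => y n j ω) hn hineq (fun j hj => hz n j hj ω)
  set a := empVariogram p n k fun j => x n j ω
  set b := empVariogram p n k fun j => y n j ω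
  set d := empVariogram p n k fun j => z n j ω
  have hb : b ≤ |γ| + 1 := by
    have := (abs_lt.1 hB1).2
    linarith [le_abs_self γ]
  have e1 : ε' * b ≤ ε / 4 := by
    calc ε' * b ≤ ε' * (|γ| + 1) := by gcongr
      _ = ε / 4 := by rw [hε']; field_simp
  have e2 : C * a ≤ ε / 4 := by
    calc C * a ≤ C * (ε / (4 * C)) := by gcongr; exact (le_abs_self a).trans hA.le
      _ = ε / 4 := by field_simp
  have e3 : |d - γ| ≤ |d - b| + |b - γ| := abs_sub_le _ _ _
  linarith

/-- Since the regressors sum to zero, `log c` can be subtracted from every response without changing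
the slope, which is then linear in the deviations. -/
theorem abs_olsIndex_add_half_le {p : ℝ} (hp : 0 < p) {m n : ℕ} (hm : m ≠ 0) {z : ℕ → ℝ} {c η : ℝ}
    (h : ∀ k ∈ Finset.Icc 1 m, |Real.log (empVariogram p n k z) - Real.log c| ≤ η) :
    |olsIndex p m n z - -(1 / 2)| ≤
      |1 / ∑ k ∈ Finset.Icc 1 m, regressor m k ^ 2| *
        (∑ k ∈ Finset.Icc 1 m, |regressor m k|) / p * η := by
  have e : ∑ k ∈ Finset.Icc 1 m, regressor m k * Real.log (empVariogram p n k z) =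
      ∑ k ∈ Finset.Icc 1 m,
        regressor m k * (Real.log (empVariogram p n k z) - Real.log c) := by
    simp only [mul_sub, Finset.sum_sub_distrib]
    rw [← Finset.sum_mul, sum_regressor hm]
    ring
  have hb : |∑ k ∈ Finset.Icc 1 m,
      regressor m k * (Real.log (empVariogram p n k z) - Real.log c)| ≤
        (∑ k ∈ Finset.Icc 1 m, |regressor m k|) * η := by
    rw [Finset.sum_mul]
    refine (Finset.abs_sum_le_sum_abs _ _).trans (Finset.sum_le_sum fun k hk => ?_)
    rw [abs_mul]
    gcongr
    exact h k hk
  rw [olsIndex, olsSlope, e, show ∀ s : ℝ, s / p - 1 / 2 - -(1 / 2) = s / p by intro s; ring,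
    abs_div, abs_mul, abs_of_pos hp, div_mul_eq_mul_div, mul_assoc]
  gcongr

/-- If the empirical variograms at all lags have the same positive limit, the estimated index tends
to `-1/2`. -/
theorem tendstoInMeasure_olsIndex {p : ℝ} (hp : 0 < p) {m : ℕ} (hm : m ≠ 0) {γ : ℝ} (hγ : 0 < γ)
    {z : ℕ → ℕ → Ω → ℝ}
    (hz : ∀ k ∈ Finset.Icc 1 m, TendstoInMeasure P
      (fun n ω => empVariogram p n k (fun j => z n j ω)) atTop (fun _ => γ)) :
    TendstoInMeasure P (fun n ω => olsIndex p m n (fun j => z n j ω)) atTop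
      (fun _ => -(1 / 2)) := by
  rw [tendstoInMeasure_iff_norm]
  intro ε hε
  set A := |1 / ∑ k ∈ Finset.Icc 1 m, regressor m k ^ 2| *
        (∑ k ∈ Finset.Icc 1 m, |regressor m k|) / p with hA
  have hA0 : 0 ≤ A := by positivity
  obtain ⟨δ, hδ, hlog⟩ := Metric.continuousAt_iff.1 (Real.continuousAt_log hγ.ne')
    (ε / (A + 1)) (by positivity)
  have hsum : Tendsto (fun n => ∑ k ∈ Finset.Icc 1 m,
      P {ω | δ ≤ ‖empVariogram p n k (fun j => z n j ω) - γ‖}) atTop (𝓝 0) := by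
    rw [show (0 : ℝ≥0∞) = ∑ k ∈ Finset.Icc 1 m, 0 by simp]
    exact tendsto_finsetSum _ fun k hk => (tendstoInMeasure_iff_norm.1 (hz k hk)) δ hδ
  refine tendsto_of_tendsto_of_tendsto_of_le_of_le tendsto_const_nhds hsum
    (fun _ => zero_le) fun n => ?_
  refine (measure_mono ?_).trans (measure_biUnion_finset_le _ _)
  intro ω hω
  by_contra hcon
  simp only [mem_iUnion, mem_ofPred_eq, not_exists, not_le] at hcon hω
  have := abs_olsIndex_add_half_le (n := n) hp hm (z := fun j => z n j ω) (c := γ)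
    (η := ε / (A + 1)) fun k hk => (hlog (hcon k hk)).le
  rw [← hA] at this
  have h2 : A * (ε / (A + 1)) < ε := by
    rw [← mul_div_assoc, div_lt_iff₀ (by positivity)]
    nlinarith
  rw [Real.norm_eq_abs] at hω
  linarith

/-! ### A criterion for negligible empirical variograms -/

/-- Exponential moments on an event control power moments. -/
theorem setLIntegral_abs_rpow_le {Y : Ω → ℝ} (hY : AEMeasurable Y P) {A : Set Ω} {K p : ℝ}
    (hK : 0 < K) (hp : 0 < p)
    (h : ∀ r : ℝ, ∫⁻ ω in A, ENNReal.ofReal (Real.exp (r * Y ω)) ∂P ≤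
      ENNReal.ofReal (Real.exp (2 * r ^ 2 * K))) :
    ∫⁻ ω in A, ENNReal.ofReal (|Y ω| ^ p) ∂P ≤
      ENNReal.ofReal (2 * p ^ p * Real.exp 2 * K ^ (p / 2)) := by
  -- At the natural scale `r = K ^ (-1/2)` the exponential moments at `r` and `-r` are at most `exp
  -- 2`, and rescaling the power produces `K ^ (p / 2)`.
  have hr : (1 / √K) ^ 2 = 1 / K := by rw [div_pow, Real.sq_sqrt hK.le, one_pow]
  set r := 1 / √K with hrdef
  have hr0 : 0 < r := by positivity
  have hpt : ∀ y : ℝ, |y| ^ p ≤ K ^ (p / 2) * p ^ p * (Real.exp (r * y) + Real.exp (-r * y)) := by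
    intro y
    have h1 := abs_rpow_le_exp_add_exp hp (r * y)
    rw [abs_mul, abs_of_pos hr0, Real.mul_rpow hr0.le (abs_nonneg _)] at h1
    have h2 : K ^ (p / 2) * r ^ p = 1 := by
      rw [hrdef, Real.div_rpow zero_le_one (Real.sqrt_nonneg _), Real.one_rpow,
        Real.sqrt_eq_rpow, ← Real.rpow_mul hK.le, show 1 / 2 * p = p / 2 by ring]
      have := Real.rpow_pos_of_pos hK (p / 2)
      field_simp
    calc |y| ^ p = K ^ (p / 2) * (r ^ p * |y| ^ p) := by rw [← mul_assoc, h2, one_mul]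
      _ ≤ K ^ (p / 2) * (p ^ p * (Real.exp (r * y) + Real.exp (-(r * y)))) := by gcongr
      _ = _ := by rw [neg_mul]; ring
  have hm : ∀ s : ℝ, AEMeasurable (fun ω => ENNReal.ofReal (Real.exp (s * Y ω))) (P.restrict A) :=
    fun s => ((hY.const_mul s).exp.ennreal_ofReal).restrict
  have hexp : ∀ s : ℝ, s ^ 2 = 1 / K →
      ∫⁻ ω in A, ENNReal.ofReal (Real.exp (s * Y ω)) ∂P ≤ ENNReal.ofReal (Real.exp 2) := by
    intro s hs
    refine (h s).trans_eq ?_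
    rw [hs]
    field_simp
  calc ∫⁻ ω in A, ENNReal.ofReal (|Y ω| ^ p) ∂P
      ≤ ∫⁻ ω in A, ENNReal.ofReal (K ^ (p / 2) * p ^ p) *
          (ENNReal.ofReal (Real.exp (r * Y ω)) + ENNReal.ofReal (Real.exp (-r * Y ω))) ∂P := by
        refine lintegral_mono fun ω => ?_
        rw [← ENNReal.ofReal_add (Real.exp_pos _).le (Real.exp_pos _).le,
          ← ENNReal.ofReal_mul (by positivity)]
        exact ENNReal.ofReal_le_ofReal (hpt _)
    _ = ENNReal.ofReal (K ^ (p / 2) * p ^ p) *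
          (∫⁻ ω in A, ENNReal.ofReal (Real.exp (r * Y ω)) ∂P +
            ∫⁻ ω in A, ENNReal.ofReal (Real.exp (-r * Y ω)) ∂P) := by
        rw [lintegral_const_mul' _ _ ENNReal.ofReal_ne_top, lintegral_add_left' (hm _)]
    _ ≤ ENNReal.ofReal (K ^ (p / 2) * p ^ p) *
          (ENNReal.ofReal (Real.exp 2) + ENNReal.ofReal (Real.exp 2)) := by
        gcongr
        · exact hexp r hr
        · exact hexp (-r) (by rw [neg_sq, hr])
    _ = _ := by
        rw [← ENNReal.ofReal_add (by positivity) (by positivity),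
          ← ENNReal.ofReal_mul (by positivity)]
        congr 1
        ring

/-- The empirical variogram vanishes in probability if the increments are conditionally
sub-Gaussian with uniformly vanishing variance proxies. -/
theorem tendstoInMeasure_empVariogram_zero {p : ℝ} (hp : 0 < p) {k : ℕ} {x : ℕ → ℕ → Ω → ℝ}
    (hx : ∀ n j, AEMeasurable (x n j) P) {Q : ℕ → ℕ → Ω → ℝ≥0∞} (hQ : ∀ n i, Measurable (Q n i))
    (hexp : ∀ n, ∀ i ∈ Finset.Icc 1 (n - k), ∀ K : ℝ, 0 < K → ∀ r : ℝ,
      ∫⁻ ω in {ω | Q n i ω ≤ ENNReal.ofReal K},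
        ENNReal.ofReal (Real.exp (r * (x n (i + k) ω - x n i ω))) ∂P ≤
          ENNReal.ofReal (Real.exp (2 * r ^ 2 * K)))
    (htail : ∀ K : ℝ, 0 < K → Tendsto
      (fun n => P {ω | ∃ i ∈ Finset.Icc 1 (n - k), ENNReal.ofReal K < Q n i ω}) atTop (𝓝 0)) :
    TendstoInMeasure P (fun n ω => empVariogram p n k (fun j => x n j ω)) atTop (fun _ => 0) := by
  rw [tendstoInMeasure_iff_norm]
  intro ε hε
  rw [ENNReal.tendsto_nhds_zero]
  intro η hη
  have hη2 : 0 < η / 2 := ENNReal.div_pos hη.ne' (by norm_num)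
  set C := 2 * p ^ p * Real.exp 2
  have hlim : Tendsto (fun K : ℝ => ENNReal.ofReal (C * K ^ (p / 2) / ε)) (𝓝[>] 0) (𝓝 0) := by
    have hc : Continuous fun K : ℝ => ENNReal.ofReal (C * K ^ (p / 2) / ε) :=
      ENNReal.continuous_ofReal.comp ((continuous_const.mul
        (Real.continuous_rpow_const (by positivity))).div_const _)
    have := hc.tendsto 0
    rw [Real.zero_rpow (by positivity)] at this
    simp only [mul_zero, zero_div, ENNReal.ofReal_zero] at this
    exact this.mono_left nhdsWithin_le_nhds
  -- `K` is fixed before `n`: it makes the Markov bound on the truncated sum at most `η / 2` for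
  -- every `n > k`, and large `n` then handles the event that some proxy exceeds `K`.
  obtain ⟨K, hK1, hK⟩ :=
    ((hlim.eventually_le_const hη2).and self_mem_nhdsWithin).exists
  replace hK : 0 < K := hK
  filter_upwards [(htail K hK).eventually_le_const hη2,
    eventually_gt_atTop k] with n hn1 hn
  set N : ℕ := n - k with hNdef
  have hN : 0 < N := by omega
  have hNR : (0 : ℝ) < N := by exact_mod_cast hN
  set A : ℕ → Set Ω := fun i => {ω | Q n i ω ≤ ENNReal.ofReal K} with hAdef
  have hAm : ∀ i, MeasurableSet (A i) := fun i => measurableSet_le (hQ n i) measurable_const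
  set f : ℕ → Ω → ℝ≥0∞ := fun i =>
    (A i).indicator fun ω => ENNReal.ofReal (|x n (i + k) ω - x n i ω| ^ p) with hf
  have hfm : ∀ i, AEMeasurable (f i) P := fun i => by
    refine AEMeasurable.indicator ?_ (hAm i)
    exact (((hx n (i + k)).sub (hx n i)).abs.pow_const p).ennreal_ofReal
  have hfi : ∀ i ∈ Finset.Icc 1 N, ∫⁻ ω, f i ω ∂P ≤ ENNReal.ofReal (C * K ^ (p / 2)) := by
    intro i hi
    rw [hf]
    simp only
    rw [lintegral_indicator (hAm i)]
    exact setLIntegral_abs_rpow_le ((hx n (i + k)).sub (hx n i)) hK hp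
      (fun r => hexp n i hi K hK r)
  have hF : ∫⁻ ω, ∑ i ∈ Finset.Icc 1 N, f i ω ∂P ≤ ENNReal.ofReal (N * (C * K ^ (p / 2))) := by
    rw [lintegral_finsetSum' _ fun i _ => hfm i]
    refine (Finset.sum_le_sum hfi).trans_eq ?_
    rw [Finset.sum_const, nsmul_eq_mul, ENNReal.ofReal_mul hNR.le, ENNReal.ofReal_natCast]
    simp
  have hmarkov : P {ω | ENNReal.ofReal (ε * N) ≤ ∑ i ∈ Finset.Icc 1 N, f i ω} ≤ η / 2 := by
    refine (meas_ge_le_lintegral_div (Finset.aemeasurable_fun_sum _ fun i _ => hfm i)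
      (by simp; positivity) ENNReal.ofReal_ne_top).trans ?_
    refine le_trans ?_ hK1
    refine (ENNReal.div_le_div_right hF _).trans_eq ?_
    rw [← ENNReal.ofReal_div_of_pos (by positivity)]
    congr 1
    field_simp
  have hsub : {ω | ε ≤ ‖empVariogram p n k (fun j => x n j ω) - 0‖} ⊆
      {ω | ∃ i ∈ Finset.Icc 1 (n - k), ENNReal.ofReal K < Q n i ω} ∪
      {ω | ENNReal.ofReal (ε * N) ≤ ∑ i ∈ Finset.Icc 1 N, f i ω} := by
    intro ω hω
    by_cases hex : ∃ i ∈ Finset.Icc 1 (n - k), ENNReal.ofReal K < Q n i ω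
    · exact Or.inl hex
    · refine Or.inr ?_
      push Not at hex
      simp only [mem_ofPred_eq, sub_zero, Real.norm_eq_abs,
        abs_of_nonneg (empVariogram_nonneg hn.le _)] at hω ⊢
      have e : ∑ i ∈ Finset.Icc 1 N, f i ω =
          ENNReal.ofReal (∑ i ∈ Finset.Icc 1 N, |x n (i + k) ω - x n i ω| ^ p) := by
        rw [ENNReal.ofReal_sum_of_nonneg fun i _ => by positivity]
        refine Finset.sum_congr rfl fun i hi => ?_
        have hi' : ω ∈ A i := hex i hi
        exact indicator_of_mem hi' _
      rw [e]
      refine ENNReal.ofReal_le_ofReal ?_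
      rw [empVariogram, ← Nat.cast_sub hn.le, one_div, ← div_eq_inv_mul, le_div_iff₀ hNR] at hω
      exact hω
  calc _ ≤ _ := measure_mono hsub
    _ ≤ _ := measure_union_le _ _
    _ ≤ η / 2 + η / 2 := add_le_add hn1 hmarkov
    _ = η := ENNReal.add_halves η

end Reduction

/-! ### Gaussian processes -/

/-- The exponent `2α + 1` is positive, and the slowly varying factor costs only half of it. -/
theorem IsFractalVariogram.tendsto_zero {α : ℝ} {γ : ℝ → ℝ} (h : IsFractalVariogram α γ) :
    Tendsto γ (𝓝[>] 0) (𝓝 0) := by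
  obtain ⟨L, L₂, hL⟩ := h
  have hα := hL.index_mem.1
  set ε := (2 * α + 1) / 2 with hε
  have hε0 : 0 < ε := by rw [hε]; linarith
  obtain ⟨C, δ, hC, hδ, hb⟩ := hL.L_slowlyVarying.exists_bound hL.L_contDiff.continuousOn hε0
  have hlim : Tendsto (fun x : ℝ => C * x ^ ε) (𝓝[>] 0) (𝓝 0) := by
    have hc : Continuous fun x : ℝ => C * x ^ ε :=
      continuous_const.mul (Real.continuous_rpow_const hε0.le)
    have := hc.tendsto 0
    rw [Real.zero_rpow hε0.ne', mul_zero] at this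
    exact this.mono_left nhdsWithin_le_nhds
  refine squeeze_zero_norm' ?_ hlim
  filter_upwards [Ioc_mem_nhdsGT hδ] with x hx
  rw [hL.scaling x hx.1, Real.norm_eq_abs, abs_mul, abs_of_pos (Real.rpow_pos_of_pos hx.1 _)]
  calc x ^ (2 * α + 1) * |L x| ≤ x ^ (2 * α + 1) * (C * x ^ (-ε)) :=
        mul_le_mul_of_nonneg_left (hb x hx) (Real.rpow_pos_of_pos hx.1 _).le
    _ = C * (x ^ (2 * α + 1) * x ^ (-ε)) := by ring
    _ = C * x ^ ε := by
        rw [← Real.rpow_add hx.1]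
        congr 2
        rw [hε]
        ring

theorem lintegral_exp_mul_gaussianReal (v : ℝ≥0) (r : ℝ) :
    ∫⁻ x, ENNReal.ofReal (Real.exp (r * x)) ∂gaussianReal 0 v =
      ENNReal.ofReal (Real.exp (v * r ^ 2 / 2)) := by
  rw [← ofReal_integral_eq_lintegral_ofReal (integrable_exp_mul_gaussianReal r)
    (ae_of_all _ fun x => (Real.exp_pos _).le)]
  have := congrFun (mgf_fun_id_gaussianReal (μ := 0) (v := v)) r
  rw [mgf] at this
  rw [this, zero_mul, zero_add]

theorem coe_add_div_eq (i k n : ℕ) :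
    (((i + k : ℕ) : ℝ≥0)) / n = (i : ℝ≥0) / n + (k : ℝ≥0) / n := by
  push_cast
  rw [add_div]

theorem tendsto_const_natCast_div {k : ℕ} (hk : 0 < k) :
    Tendsto (fun n : ℕ => (k : ℝ) / n) atTop (𝓝[>] 0) := by
  refine tendsto_nhdsWithin_iff.2 ⟨tendsto_const_div_atTop_nhds_zero_nat _, ?_⟩
  filter_upwards [eventually_gt_atTop 0] with n hn
  have hk' : (0 : ℝ) < k := by exact_mod_cast hk
  have hn' : (0 : ℝ) < n := by exact_mod_cast hn
  exact div_pos hk' hn'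

section Gaussian

variable {Ω : Type*} [mΩ : MeasurableSpace Ω] {P : Measure Ω}

/-- The increments are centred Gaussian with variance `γ (k / n)`, so the variance proxy is
deterministic: its tail event is eventually empty. -/
theorem IsGaussianFractal.tendstoInMeasure_empVariogram {α : ℝ} {X : ℝ≥0 → Ω → ℝ}
    (hX : IsGaussianFractal P α X) {p : ℝ} (hp : 0 < p) {k : ℕ} (hk : 0 < k) :
    TendstoInMeasure P (fun n ω => empVariogram p n k (fun j => X ((j : ℝ≥0) / n) ω)) atTop
      (fun _ => 0) := by
  obtain ⟨γ, hγ, hγf⟩ := hX.fractal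
  have hlim : Tendsto (fun n : ℕ => γ (k / n)) atTop (𝓝 0) :=
    hγf.tendsto_zero.comp (tendsto_const_natCast_div hk)
  refine tendstoInMeasure_empVariogram_zero hp (fun n j => hX.gaussian.aemeasurable _)
    (Q := fun n _ _ => ENNReal.ofReal (γ (k / n))) (fun _ _ => measurable_const) ?_ ?_
  · intro n i _ K hK r
    by_cases hle : γ (k / n) ≤ K
    · have hg : HasGaussianLaw (fun ω => X ((i : ℝ≥0) / n + (k : ℝ≥0) / n) ω - X (i / n) ω) P :=
        hX.gaussian.hasGaussianLaw_fun_sub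
      have hmean : ∫ ω, (X ((i : ℝ≥0) / n + (k : ℝ≥0) / n) ω - X (i / n) ω) ∂P = 0 := by
        rw [integral_sub (hX.gaussian.hasGaussianLaw_eval _).integrable
          (hX.gaussian.hasGaussianLaw_eval _).integrable, hX.zero_mean, hX.zero_mean, sub_zero]
      have hvar : Var[fun ω => X ((i : ℝ≥0) / n + (k : ℝ≥0) / n) ω - X (i / n) ω; P] =
          γ (k / n) := by
        rw [variance_of_integral_eq_zero hg.aemeasurable hmean]
        have := (hγ ((i : ℝ≥0) / n) ((k : ℝ≥0) / n)).2
        simp only [Real.rpow_two, sq_abs] at this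
        simpa using this
      have hlaw := hg.map_eq_gaussianReal
      rw [hmean, hvar] at hlaw
      have hm : Measurable fun x : ℝ => ENNReal.ofReal (Real.exp (r * x)) := by fun_prop
      calc _ ≤ ∫⁻ ω, ENNReal.ofReal (Real.exp (r * (X (((i + k : ℕ) : ℝ≥0) / n) ω
              - X (i / n) ω))) ∂P := setLIntegral_le_lintegral _ _
        _ = ∫⁻ x, ENNReal.ofReal (Real.exp (r * x)) ∂gaussianReal 0 (γ (k / n)).toNNReal := by
            rw [← hlaw, lintegral_map' hm.aemeasurable hg.aemeasurable, coe_add_div_eq]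
        _ = _ := lintegral_exp_mul_gaussianReal _ _
        _ ≤ _ := by
            refine ENNReal.ofReal_le_ofReal (Real.exp_le_exp.2 ?_)
            have : ((γ (k / n)).toNNReal : ℝ) ≤ K := by
              rw [Real.coe_toNNReal']
              exact max_le hle hK.le
            nlinarith [sq_nonneg r]
    · have : {ω : Ω | ENNReal.ofReal (γ (k / n)) ≤ ENNReal.ofReal K} = ∅ := by
        rw [eq_empty_iff_forall_notMem]
        intro ω hω
        exact hle ((ENNReal.ofReal_le_ofReal_iff hK.le).1 hω)
      rw [this]
      simp
  · intro K hK
    refine tendsto_const_nhds.congr' ?_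
    filter_upwards [hlim.eventually_le_const hK] with n hn
    have : {ω : Ω | ∃ i ∈ Finset.Icc 1 (n - k),
        ENNReal.ofReal K < ENNReal.ofReal (γ (k / n))} = ∅ := by
      rw [eq_empty_iff_forall_notMem]
      rintro ω ⟨i, -, hω⟩
      exact absurd hω (not_lt.2 (ENNReal.ofReal_le_ofReal hn))
    rw [this, measure_empty]

end Gaussian

/-! ### Pathwise Riemann–Stieltjes integrals -/

/-- `S` is a tagged Riemann–Stieltjes sum of `f` against `g` over `[a, b]` of mesh below `δ`. -/
def IsRSSum (δ : ℝ) (f g : ℝ≥0 → ℝ) (a b : ℝ≥0) (S : ℝ) : Prop :=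
  ∃ (n : ℕ) (τ ξ : ℕ → ℝ≥0), Monotone τ ∧ τ 0 = a ∧ τ n = b ∧
    (∀ i < n, (τ (i + 1) : ℝ) - τ i < δ) ∧ (∀ i < n, ξ i ∈ Icc (τ i) (τ (i + 1))) ∧
    S = ∑ i ∈ Finset.range n, f (ξ i) * (g (τ (i + 1)) - g (τ i))

theorem IsRSSum.single {δ : ℝ} {f g : ℝ≥0 → ℝ} {a b s : ℝ≥0} (hs : s ∈ Icc a b)
    (hab : (b : ℝ) - a < δ) : IsRSSum δ f g a b (f s * (g b - g a)) := by
  refine ⟨1, fun i => if i = 0 then a else b, fun _ => s, ?_, by simp, by simp, ?_, ?_, by simp⟩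
  · refine monotone_nat_of_le_succ fun i => ?_
    rcases i with _ | i
    · simpa using hs.1.trans hs.2
    · simp
  · intro i hi
    obtain rfl : i = 0 := by omega
    simpa using hab
  · intro i hi
    obtain rfl : i = 0 := by omega
    simpa using hs

theorem IsRSSum.trans {δ : ℝ} {f g : ℝ≥0 → ℝ} {a b c : ℝ≥0} {S S' : ℝ}
    (h : IsRSSum δ f g a b S) (h' : IsRSSum δ f g b c S') : IsRSSum δ f g a c (S + S') := by
  obtain ⟨n, τ, ξ, hτ, h0, hn, hmesh, htag, rfl⟩ := h
  obtain ⟨n', τ', ξ', hτ', h0', hn', hmesh', htag', rfl⟩ := h'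
  set T : ℕ → ℝ≥0 := fun i => if i ≤ n then τ i else τ' (i - n) with hT
  have hle : ∀ i ≤ n, T i = τ i := fun i hi => if_pos hi
  have hge : ∀ i, T (n + i) = τ' i := by
    intro i
    rcases i with _ | i
    · rw [add_zero, hle n le_rfl, hn, h0']
    · rw [hT]
      simp
  have hmono : Monotone T := by
    refine monotone_nat_of_le_succ fun i => ?_
    rcases lt_or_ge i n with hi | hi
    · rw [hle i hi.le, hle (i + 1) hi]
      exact hτ (Nat.le_succ i)
    · obtain ⟨j, rfl⟩ := Nat.exists_eq_add_of_le hi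
      rw [hge, add_assoc, hge]
      exact hτ' (Nat.le_succ j)
  set Ξ : ℕ → ℝ≥0 := fun i => if i < n then ξ i else ξ' (i - n) with hΞ
  have hΞlt : ∀ i < n, Ξ i = ξ i := fun i hi => if_pos hi
  have hΞge : ∀ i, Ξ (n + i) = ξ' i := fun i => by simp [hΞ]
  refine ⟨n + n', T, Ξ, hmono, ?_, ?_, ?_, ?_, ?_⟩
  · rw [hle 0 (Nat.zero_le n), h0]
  · rw [hge, hn']
  · intro i hi
    rcases lt_or_ge i n with h | h
    · rw [hle i h.le, hle (i + 1) h]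
      exact hmesh i h
    · obtain ⟨j, rfl⟩ := Nat.exists_eq_add_of_le h
      rw [hge, add_assoc, hge]
      exact hmesh' j (by omega)
  · intro i hi
    rcases lt_or_ge i n with h | h
    · rw [hle i h.le, hle (i + 1) h, hΞlt i h]
      exact htag i h
    · obtain ⟨j, rfl⟩ := Nat.exists_eq_add_of_le h
      rw [hge, add_assoc, hge, hΞge]
      exact htag' j (by omega)
  · rw [Finset.sum_range_add]
    congr 1
    · refine Finset.sum_congr rfl fun i hi => ?_
      have hi := Finset.mem_range.1 hi
      rw [hle i hi.le, hle (i + 1) hi, hΞlt i hi]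
    · refine Finset.sum_congr rfl fun i _ => ?_
      rw [hge, add_assoc, hge, hΞge]

theorem exists_isRSSum {δ : ℝ} (hδ : 0 < δ) (f g : ℝ≥0 → ℝ) {a b : ℝ≥0} (hab : a ≤ b) :
    ∃ S, IsRSSum δ f g a b S := by
  obtain ⟨d, hd0, hd⟩ : ∃ d : ℝ≥0, 0 < d ∧ (d : ℝ) < δ :=
    ⟨(δ / 2).toNNReal, Real.toNNReal_pos.2 (half_pos hδ), by
      rw [Real.coe_toNNReal _ (half_pos hδ).le]; exact half_lt_self hδ⟩
  obtain ⟨n, hn⟩ := exists_nat_ge (b / d)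
  rw [div_le_iff₀ hd0] at hn
  have hmono : Monotone fun i : ℕ => min (a + i * d) b := by
    intro i j hij
    dsimp only
    gcongr
  refine ⟨_, n, fun i => min (a + i * d) b, fun i => min (a + i * d) b, hmono, by simpa using hab,
    min_eq_right (hn.trans le_add_self), ?_, fun i _ => ⟨le_rfl, hmono (Nat.le_succ i)⟩, rfl⟩
  intro i _
  push_cast
  refine lt_of_le_of_lt ?_ hd
  rcases le_total ((a : ℝ) + i * d) b with h | h
  · rw [min_eq_left h]
    linarith [min_le_left ((a : ℝ) + (i + 1) * d) b]
  · rw [min_eq_right h]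
    linarith [min_le_right ((a : ℝ) + (i + 1) * d) b, d.coe_nonneg]

/-- Increments of an indefinite Riemann–Stieltjes integral over short intervals are close, uniformly
in the interval, to those obtained by freezing the integrand. -/
theorem IsRSIntegral.exists_abs_increment_sub_le {f g J : ℝ≥0 → ℝ}
    (hJ : ∀ t, IsRSIntegral f g t (J t)) (T : ℝ≥0) {ε : ℝ} (hε : 0 < ε) :
    ∃ δ : ℝ, 0 < δ ∧ ∀ a b : ℝ≥0, a ≤ b → b ≤ T → (b : ℝ) - a < δ →
      |J b - J a - f a * (g b - g a)| ≤ ε := by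
  have hsum : ∀ t : ℝ≥0, ∀ η : ℝ, 0 < η → ∃ δ : ℝ, 0 < δ ∧
      ∀ δ' ≤ δ, ∀ S, IsRSSum δ' f g 0 t S → |S - J t| < η := by
    intro t η hη
    obtain ⟨δ, hδ, h⟩ := hJ t η hη
    refine ⟨δ, hδ, ?_⟩
    rintro δ' hδ' S ⟨n, τ, ξ, hτ, h0, hn, hmesh, htag, rfl⟩
    exact h n τ ξ hτ h0 hn (fun i hi => (hmesh i hi).trans_le hδ') htag
  obtain ⟨δ, hδ, h⟩ := hsum T (ε / 2) (half_pos hε)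
  refine ⟨δ, hδ, fun a b hab hbT hd => le_of_forall_pos_le_add fun η hη => ?_⟩
  obtain ⟨δa, hδa, ha⟩ := hsum a (η / 2) (half_pos hη)
  obtain ⟨δb, hδb, hb⟩ := hsum b (η / 2) (half_pos hη)
  set δ' := min δ (min δa δb)
  have hδ' : 0 < δ' := by positivity
  have h1 : δ' ≤ δ := min_le_left _ _
  have h2 : δ' ≤ δa := (min_le_right _ _).trans (min_le_left _ _)
  have h3 : δ' ≤ δb := (min_le_right _ _).trans (min_le_right _ _)
  have mono : ∀ {u v S}, IsRSSum δ' f g u v S → IsRSSum δ f g u v S := by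
    rintro u v S ⟨n, τ, ξ, hτ, h0, hn, hmesh, htag, rfl⟩
    exact ⟨n, τ, ξ, hτ, h0, hn, fun i hi => (hmesh i hi).trans_le h1, htag, rfl⟩
  -- Two sums over `[0, T]` are compared, both within `ε / 2` of `J T`: one glues `A`, the single
  -- cell `[a, b]` tagged at `a`, and `R`; the other glues `B` and `R`. Their difference cancels
  -- `R`, while `A` and `B` approximate `J a` and `J b` up to `η / 2`.
  obtain ⟨A, hA⟩ := exists_isRSSum hδ' f g (zero_le (a := a))
  obtain ⟨B, hB⟩ := exists_isRSSum hδ' f g (zero_le (a := b))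
  obtain ⟨R, hR⟩ := exists_isRSSum hδ' f g hbT
  have e1 := h δ le_rfl _ (((mono hA).trans (IsRSSum.single ⟨le_rfl, hab⟩ hd)).trans (mono hR))
  have e2 := h δ le_rfl _ ((mono hB).trans (mono hR))
  have e3 := ha δ' h2 _ hA
  have e4 := hb δ' h3 _ hB
  rw [abs_lt] at e1 e2 e3 e4
  rw [abs_le]
  constructor <;> linarith

/-- The partition with the two points `0` and `t` already bounds `|f t - f 0|`. -/
theorem FiniteVariation.exists_bound {q : ℝ} (hq : 0 < q) {f : ℝ≥0 → ℝ} (hf : FiniteVariation q f)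
    (T : ℝ≥0) : ∃ M : ℝ, 0 < M ∧ ∀ t ≤ T, |f t| ≤ M := by
  obtain ⟨C, hC⟩ := hf T
  have hC0 : 0 ≤ C := by simpa using hC 0 (fun _ => 0) monotone_const (fun _ => zero_le)
  refine ⟨|f 0| + C ^ (1 / q) + 1, by positivity, fun t ht => ?_⟩
  have h := hC 1 (fun i => if i = 0 then 0 else t) (monotone_nat_of_le_succ fun i => by
    rcases i with _ | i <;> simp) (fun i => by split_ifs <;> simp [ht])
  simp only [Finset.range_one, Finset.sum_singleton, zero_add, one_ne_zero, if_false,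
    if_true] at h
  have h1 : |f t - f 0| ≤ C ^ (1 / q) := by
    have := Real.rpow_le_rpow (by positivity) h (by positivity : 0 ≤ 1 / q)
    rwa [← Real.rpow_mul (abs_nonneg _), mul_one_div_cancel hq.ne', Real.rpow_one] at this
  have h2 : |f t| ≤ |f t - f 0| + |f 0| := by
    simpa using abs_add_le (f t - f 0) (f 0)
  linarith

theorem empVariogram_le_of_abs_sub_le {p ε M : ℝ} (hp : 0 < p)
    {n k : ℕ} (hk : k < n) {x g s : ℕ → ℝ} (hs : ∀ i ∈ Finset.Icc 1 (n - k), |s i| ≤ M)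
    (h : ∀ i ∈ Finset.Icc 1 (n - k), |x (i + k) - x i - s i * (g (i + k) - g i)| ≤ ε) :
    empVariogram p n k x ≤ 2 ^ p * (ε ^ p + M ^ p * empVariogram p n k g) := by
  have hN : 0 < n - k := by omega
  have hNR : (0 : ℝ) < (n - k : ℕ) := by exact_mod_cast hN
  have hterm : ∀ i ∈ Finset.Icc 1 (n - k), |x (i + k) - x i| ^ p ≤
      2 ^ p * ε ^ p + 2 ^ p * M ^ p * |g (i + k) - g i| ^ p := by
    intro i hi
    have e := abs_add_rpow_le hp (x (i + k) - x i - s i * (g (i + k) - g i))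
      (s i * (g (i + k) - g i))
    rw [sub_add_cancel, abs_mul, Real.mul_rpow (abs_nonneg _) (abs_nonneg _)] at e
    refine e.trans ?_
    have h1 := Real.rpow_le_rpow (abs_nonneg _) (h i hi) hp.le
    have h2 := Real.rpow_le_rpow (abs_nonneg _) (hs i hi) hp.le
    have h3 : 0 ≤ |g (i + k) - g i| ^ p := by positivity
    have h4 : (0 : ℝ) ≤ 2 ^ p := by positivity
    rw [mul_add, mul_assoc]
    gcongr
  have hsum := Finset.sum_le_sum hterm
  rw [Finset.sum_add_distrib, ← Finset.mul_sum _ _ (2 ^ p * M ^ p)] at hsum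
  simp only [Finset.sum_const, Nat.card_Icc, Nat.add_sub_cancel, nsmul_eq_mul] at hsum
  unfold empVariogram
  rw [← Nat.cast_sub hk.le]
  calc _ ≤ 1 / ((n - k : ℕ) : ℝ) * (((n - k : ℕ) : ℝ) * (2 ^ p * ε ^ p) +
        2 ^ p * M ^ p * ∑ i ∈ Finset.Icc 1 (n - k), |g (i + k) - g i| ^ p) := by gcongr
    _ = _ := by field_simp

section StochasticVolatility

variable {Ω : Type*} [mΩ : MeasurableSpace Ω] {P : Measure Ω}

theorem aestronglyMeasurable_empVariogram {p : ℝ} {n k : ℕ} {x : ℕ → Ω → ℝ}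
    (hx : ∀ j, AEMeasurable (x j) P) :
    AEStronglyMeasurable (fun ω => empVariogram p n k (fun j => x j ω)) P := by
  refine AEMeasurable.aestronglyMeasurable ?_
  exact (Finset.aemeasurable_fun_sum _ fun i _ =>
    ((hx (i + k)).sub (hx i)).abs.pow_const p).const_mul _

theorem IsStochasticVolatility.tendstoInMeasure_empVariogram [IsFiniteMeasure P] {α : ℝ} {X : ℝ≥0 → Ω → ℝ}
    (hXm : ∀ t, AEMeasurable (X t) P) (hX : IsStochasticVolatility P α X) {p : ℝ} (hp : 0 < p)
    {k : ℕ} (hk : 0 < k) :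
    TendstoInMeasure P (fun n ω => empVariogram p n k (fun j => X ((j : ℝ≥0) / n) ω)) atTop
      (fun _ => 0) := by
  obtain ⟨G, σ, hG, -, ⟨q, hq, -, hσ⟩, hint⟩ := hX
  have hGlim := hG.tendstoInMeasure_empVariogram hp hk
  -- Passing to almost surely convergent subsequences makes the comparison with `G` a statement
  -- about one path, where the bound on `σ` and the modulus `δ` may depend on `ω`.
  rw [exists_seq_tendstoInMeasure_atTop_iff
    (fun n => aestronglyMeasurable_empVariogram fun j => hG.gaussian.aemeasurable _)] at hGlim
  rw [exists_seq_tendstoInMeasure_atTop_iff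
    (fun n => aestronglyMeasurable_empVariogram fun j => hXm _)]
  intro ns hns
  obtain ⟨ns', hns', hae⟩ := hGlim ns hns
  refine ⟨ns', hns', ?_⟩
  filter_upwards [hae, hσ, hint] with ω h1 h2 h3
  obtain ⟨M, hM, hMb⟩ := h2.exists_bound hq 1
  have hto : Tendsto (fun i => ns (ns' i)) atTop atTop :=
    hns.tendsto_atTop.comp hns'.tendsto_atTop
  rw [Metric.tendsto_nhds]
  intro η hη
  have hcont : Tendsto (fun ε : ℝ => 2 ^ p * (ε ^ p + M ^ p * ε)) (𝓝[>] 0) (𝓝 0) := by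
    have hc : Continuous fun ε : ℝ => 2 ^ p * (ε ^ p + M ^ p * ε) :=
      continuous_const.mul ((Real.continuous_rpow_const hp.le).add
        (continuous_const.mul continuous_id))
    have := hc.tendsto 0
    rw [Real.zero_rpow hp.ne', mul_zero, add_zero, mul_zero] at this
    exact this.mono_left nhdsWithin_le_nhds
  obtain ⟨ε, hε1, hε⟩ := ((hcont.eventually_lt_const hη).and self_mem_nhdsWithin).exists
  replace hε : 0 < ε := hε
  obtain ⟨δ, hδ, hinc⟩ := IsRSIntegral.exists_abs_increment_sub_le h3 1 hε
  have hkn : Tendsto (fun i => (k : ℝ) / (ns (ns' i) : ℕ)) atTop (𝓝 0) :=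
    (tendsto_const_div_atTop_nhds_zero_nat _).comp hto
  filter_upwards [h1.eventually_lt_const hε, hkn.eventually_lt_const hδ,
    hto.eventually_gt_atTop k] with i hi1 hi2 hi3
  set n := ns (ns' i)
  have hn : 0 < n := by omega
  have hn0 : (n : ℝ≥0) ≠ 0 := by exact_mod_cast hn.ne'
  have hle1 : ∀ j ≤ n, (j : ℝ≥0) / n ≤ 1 := by
    intro j hj
    exact div_le_one_of_le₀ (by exact_mod_cast hj) zero_le
  have hbound := empVariogram_le_of_abs_sub_le (ε := ε) hp hi3
    (x := fun j => X ((j : ℝ≥0) / n) ω) (g := fun j => G ((j : ℝ≥0) / n) ω)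
    (s := fun j => σ ((j : ℝ≥0) / n) ω)
    (fun j hj => hMb _ (hle1 j (by simp only [Finset.mem_Icc] at hj; omega)))
    (fun j hj => by
      have hj' : j + k ≤ n := by simp only [Finset.mem_Icc] at hj; omega
      have := hinc ((j : ℝ≥0) / n) (((j + k : ℕ) : ℝ≥0) / n)
        (by rw [coe_add_div_eq]; exact le_self_add) (hle1 _ hj')
        (by rw [coe_add_div_eq]; push_cast; rw [add_sub_cancel_left]; exact hi2)
      rwa [sub_sub_sub_cancel_right] at this)
  rw [Real.dist_eq, sub_zero,
    abs_of_nonneg (empVariogram_nonneg hi3.le _)]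
  refine (hbound.trans ?_).trans_lt hε1
  gcongr

end StochasticVolatility

/-! ### Simple processes -/

theorem exists_monotone_grid (B : Finset ℝ) :
    ∃ (N : ℕ) (τ : ℕ → ℝ), Monotone τ ∧ ∀ b ∈ B, ∃ i ≤ N, τ i = b := by
  induction B using Finset.induction_on_max with
  | empty => exact ⟨0, fun _ => 0, monotone_const, by simp⟩
  | insert a B hB ih =>
    obtain ⟨N, τ, hτ, h⟩ := ih
    -- Filler values of `τ`, such as the initial `0`, may exceed the new maximum `a`. Capping by `a`
    -- restores monotonicity and leaves the points of `B`, all below `a`, in place.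
    refine ⟨N + 1, fun i => if i ≤ N then min (τ i) a else a, ?_, ?_⟩
    · refine monotone_nat_of_le_succ fun i => ?_
      by_cases h1 : i + 1 ≤ N
      · simp only [h1, (Nat.le_succ i).trans h1, if_true]
        exact min_le_min_right _ (hτ (Nat.le_succ i))
      · simp only [h1, if_false]
        split_ifs
        · exact min_le_right _ _
        · exact le_rfl
    · intro b hb
      rcases Finset.mem_insert.1 hb with rfl | hb
      · exact ⟨N + 1, le_rfl, by simp⟩
      · obtain ⟨i, hi, rfl⟩ := h b hb
        exact ⟨i, hi.trans (Nat.le_succ N), by simp [hi, (hB _ hb).le]⟩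

theorem sum_indicator_Ioc {τ : ℕ → ℝ} (hτ : Monotone τ) {N j : ℕ} (hj : j < N) (c : ℕ → ℝ) {s : ℝ}
    (hs : s ∈ Ioc (τ j) (τ (j + 1))) :
    ∑ i ∈ Finset.range N, (Ioc (τ i) (τ (i + 1))).indicator (fun _ => c i) s = c j := by
  rw [Finset.sum_eq_single j, indicator_of_mem hs]
  · intro i _ hij
    refine indicator_of_notMem (fun hi => ?_) _
    exact Set.disjoint_left.1 (hτ.pairwise_disjoint_on_Ioc_succ hij) hi hs
  · intro h
    exact absurd (Finset.mem_range.2 hj) h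

/-- No grid point lies strictly inside a cell; as cells are left-open, the right end represents the
whole cell. -/
theorem mem_Ioc_iff_of_grid {τ : ℕ → ℝ} (hτ : Monotone τ) {i : ℕ} {s u v : ℝ}
    (hu : ∃ a, τ a = u) (hv : ∃ a, τ a = v) (hs : s ∈ Ioc (τ i) (τ (i + 1))) :
    s ∈ Ioc u v ↔ τ (i + 1) ∈ Ioc u v := by
  have key : ∀ w : ℝ, (∃ a, τ a = w) → (w < s ↔ w < τ (i + 1)) := by
    rintro _ ⟨a, rfl⟩
    refine ⟨fun h => h.trans_le hs.2, fun h => ?_⟩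
    have : a ≤ i := Nat.lt_succ_iff.1 (hτ.reflect_lt h)
    exact (hτ this).trans_lt hs.1
  rw [mem_Ioc, mem_Ioc, key u hu, ← not_lt, ← not_lt, key v hv]

namespace SimpleProcess

variable {Ω : Type*} [mΩ : MeasurableSpace Ω] {𝓕 : Filtration ℝ mΩ}

/-- The sequence `τ 0 ≤ … ≤ τ N` refines the partition of a simple process. -/
def IsRefinedBy (H : SimpleProcess 𝓕) (N : ℕ) (τ : ℕ → ℝ) : Prop :=
  ∀ j ≤ H.n, ∃ i ≤ N, τ i = H.time j

variable {H : SimpleProcess 𝓕} {N : ℕ} {τ : ℕ → ℝ}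

theorem val_eq_of_mem (hτ : Monotone τ) (hH : H.IsRefinedBy N τ) {i : ℕ} {s : ℝ}
    (hs : s ∈ Ioc (τ i) (τ (i + 1))) (ω : Ω) : H.val s ω = H.val (τ (i + 1)) ω := by
  unfold val
  refine Finset.sum_congr rfl fun j hj => ?_
  have hj := Finset.mem_range.1 hj
  obtain ⟨a, -, ha⟩ := hH j hj.le
  obtain ⟨b, -, hb⟩ := hH (j + 1) hj
  have := mem_Ioc_iff_of_grid hτ ⟨a, ha⟩ ⟨b, hb⟩ hs
  simp only [indicator_apply, this]

theorem val_eq_zero (hτ : Monotone τ) (hH : H.IsRefinedBy N τ) {s : ℝ}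
    (hs : ∀ i < N, s ∉ Ioc (τ i) (τ (i + 1))) (ω : Ω) : H.val s ω = 0 := by
  unfold val
  refine Finset.sum_eq_zero fun j hj => indicator_of_notMem (fun hmem => ?_) _
  have hj := Finset.mem_range.1 hj
  obtain ⟨a, -, ha⟩ := hH j hj.le
  obtain ⟨b, hbN, hb⟩ := hH (j + 1) hj
  rw [← ha, ← hb] at hmem
  -- Descending from a grid point at or above `s` must meet the cell containing `s` before it
  -- reaches `τ a < s`.
  have aux : ∀ d, d ≤ N → s ≤ τ d → a ≤ d → False := by
    intro d
    induction d with
    | zero =>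
      intro _ h1 h2
      obtain rfl : a = 0 := by omega
      exact absurd hmem.1 (not_lt.2 h1)
    | succ d ih =>
      intro h0 h1 h2
      by_cases h : τ d < s
      · exact hs d (by omega) ⟨h, h1⟩
      · rcases Nat.lt_or_ge d a with h3 | h3
        · obtain rfl : a = d + 1 := by omega
          exact absurd hmem.1 (not_lt.2 h1)
        · exact ih (by omega) (not_lt.1 h) h3
  rcases le_total a b with h | h
  · exact aux b hbN hmem.2 h
  · exact absurd (hmem.1.trans_le hmem.2) (not_lt.2 (hτ h))

/-- An interval of `H` that contains the right end of a cell starts at an earlier grid point, hence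
no later than the left end: this is predictability. -/
theorem measurable_val (hτ : Monotone τ) (hH : H.IsRefinedBy N τ) (i : ℕ) :
    Measurable[𝓕 (τ i)] (H.val (τ (i + 1))) := by
  unfold val
  refine Finset.measurable_fun_sum _ fun j hj => ?_
  have hj := Finset.mem_range.1 hj
  by_cases hmem : τ (i + 1) ∈ Ioc (H.time j) (H.time (j + 1))
  · simp only [indicator_of_mem hmem]
    obtain ⟨a, -, ha⟩ := hH j hj.le
    have hlt := hmem.1
    rw [← ha] at hlt
    have : a ≤ i := Nat.lt_succ_iff.1 (hτ.reflect_lt hlt)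
    exact (H.coeff_measurable j).mono (𝓕.mono (ha ▸ hτ this)) le_rfl
  · simp only [indicator_of_notMem hmem]
    exact measurable_const

theorem exists_abs_val_le (H : SimpleProcess 𝓕) (s : ℝ) : ∃ C : ℝ, ∀ ω, |H.val s ω| ≤ C := by
  choose C hC using H.coeff_bounded
  refine ⟨∑ j ∈ Finset.range H.n, |C j|, fun ω => ?_⟩
  refine (Finset.abs_sum_le_sum_abs _ _).trans (Finset.sum_le_sum fun j _ => ?_)
  rw [indicator_apply]
  split_ifs
  · exact (hC j ω).trans (le_abs_self _)
  · simp

theorem integral_eq_sum_grid (hτ : Monotone τ) (hH : H.IsRefinedBy N τ) (W : ℝ → Ω → ℝ) (ω : Ω) :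
    H.integral W ω =
      ∑ i ∈ Finset.range N, H.val (τ (i + 1)) ω * (W (τ (i + 1)) ω - W (τ i) ω) := by
  simp only [val, Finset.sum_mul]
  rw [Finset.sum_comm, integral]
  refine Finset.sum_congr rfl fun j hj => ?_
  have hj := Finset.mem_range.1 hj
  obtain ⟨a, haN, ha⟩ := hH j hj.le
  obtain ⟨b, hbN, hb⟩ := hH (j + 1) hj
  have huv : H.time j ≤ H.time (j + 1) := H.time_mono (Nat.le_succ j)
  set u := H.time j
  set v := H.time (j + 1)
  -- Clamping time to `[u, v]` replaces the indicator, so the sum over the grid telescopes.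
  set φ : ℝ → ℝ := fun x => W (min (max x u) v) ω with hφ
  have hterm : ∀ i, (Ioc u v).indicator (fun _ => H.coeff j ω) (τ (i + 1)) *
      (W (τ (i + 1)) ω - W (τ i) ω) = H.coeff j ω * (φ (τ (i + 1)) - φ (τ i)) := by
    intro i
    have hi : τ i ≤ τ (i + 1) := hτ (Nat.le_succ i)
    by_cases h1 : u < τ (i + 1)
    · have h1' : u ≤ τ i := by
        rw [← ha] at h1 ⊢
        exact hτ (Nat.lt_succ_iff.1 (hτ.reflect_lt h1))
      by_cases h2 : τ (i + 1) ≤ v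
      · rw [indicator_of_mem (show τ (i + 1) ∈ Ioc u v from ⟨h1, h2⟩), hφ]
        simp only [max_eq_left h1.le, max_eq_left h1', min_eq_left h2, min_eq_left (hi.trans h2)]
      · have h2' : v ≤ τ i := by
          rw [not_le, ← hb] at h2
          rw [← hb]
          exact hτ (Nat.lt_succ_iff.1 (hτ.reflect_lt h2))
        rw [indicator_of_notMem (fun h => h2 h.2), hφ]
        simp only [max_eq_left h1.le, max_eq_left h1', min_eq_right h2', min_eq_right (h2'.trans hi)]
        simp
    · rw [indicator_of_notMem (fun h => h1 h.1), hφ]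
      rw [not_lt] at h1
      simp only [max_eq_right h1, max_eq_right (hi.trans h1)]
      simp
  rw [Finset.sum_congr rfl fun i _ => hterm i, ← Finset.mul_sum,
    Finset.sum_range_sub (fun i => φ (τ i))]
  have h0 : φ (τ 0) = W u ω := by
    have : τ 0 ≤ u := ha ▸ hτ (Nat.zero_le a)
    simp only [hφ, max_eq_right this, min_eq_left huv]
  have hN : φ (τ N) = W v ω := by
    have : v ≤ τ N := hb ▸ hτ hbN
    simp only [hφ, max_eq_left (huv.trans this), min_eq_right this]
  rw [h0, hN]

/-- On a common refinement of the two partitions the difference is again simple. This makes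
increments of an Itô-type process Itô integrals themselves. -/
theorem exists_sub (H H' : SimpleProcess 𝓕) : ∃ S : SimpleProcess 𝓕,
    (∀ s ω, S.val s ω = H.val s ω - H'.val s ω) ∧
    ∀ W ω, S.integral W ω = H.integral W ω - H'.integral W ω := by
  obtain ⟨N, τ, hτ, h⟩ := exists_monotone_grid
    ((Finset.range (H.n + 1)).image H.time ∪ (Finset.range (H'.n + 1)).image H'.time)
  have hH : H.IsRefinedBy N τ := fun j hj => h _ (Finset.mem_union_left _
    (Finset.mem_image_of_mem _ (Finset.mem_range.2 (by omega))))
  have hH' : H'.IsRefinedBy N τ := fun j hj => h _ (Finset.mem_union_right _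
    (Finset.mem_image_of_mem _ (Finset.mem_range.2 (by omega))))
  refine ⟨⟨N, τ, hτ, fun i ω => H.val (τ (i + 1)) ω - H'.val (τ (i + 1)) ω,
    fun i => (measurable_val hτ hH i).sub (measurable_val hτ hH' i), fun i => ?_⟩, ?_, ?_⟩
  · obtain ⟨C, hC⟩ := H.exists_abs_val_le (τ (i + 1))
    obtain ⟨C', hC'⟩ := H'.exists_abs_val_le (τ (i + 1))
    exact ⟨C + C', fun ω => (abs_sub _ _).trans (add_le_add (hC ω) (hC' ω))⟩
  · intro s ω
    by_cases hs : ∃ i < N, s ∈ Ioc (τ i) (τ (i + 1))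
    · obtain ⟨i, hi, hs⟩ := hs
      rw [val_eq_of_mem hτ hH hs, val_eq_of_mem hτ hH' hs]
      exact sum_indicator_Ioc hτ hi
        (fun i => H.val (τ (i + 1)) ω - H'.val (τ (i + 1)) ω) hs
    · push Not at hs
      rw [val_eq_zero hτ hH hs, val_eq_zero hτ hH' hs, sub_zero]
      exact Finset.sum_eq_zero fun i hi => indicator_of_notMem (hs i (Finset.mem_range.1 hi)) _
  · intro W ω
    rw [integral_eq_sum_grid hτ hH, integral_eq_sum_grid hτ hH', ← Finset.sum_sub_distrib]
    exact Finset.sum_congr rfl fun i _ => sub_mul _ _ _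

end SimpleProcess

/-! ### Exponential moments of Itô integrals -/

/-- By independence `Z` and `ξ` can be frozen, and by Fubini the inner integral is the Gaussian
moment generating function, which the compensator `ξ² v / 2` normalises to one. -/
theorem lintegral_mul_exp_gaussian {Ω : Type*} {m mΩ : MeasurableSpace Ω} {P : Measure Ω}
    [IsFiniteMeasure P] (hm : m ≤ mΩ)
    {Z : Ω → ℝ≥0∞} (hZ : Measurable[m] Z) {ξ D : Ω → ℝ} (hξ : Measurable[m] ξ) {v : ℝ≥0}
    (hD : HasLaw D (gaussianReal 0 v) P)
    (hind : Indep m (MeasurableSpace.comap D inferInstance) P) :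
    ∫⁻ ω, Z ω * ENNReal.ofReal (Real.exp (ξ ω * D ω - ξ ω ^ 2 * v / 2)) ∂P = ∫⁻ ω, Z ω ∂P := by
  have hpair : Measurable[m] fun ω => (Z ω, ξ ω) := hZ.prodMk hξ
  have hif : IndepFun (fun ω => (Z ω, ξ ω)) D P := by
    rw [IndepFun_iff_Indep]
    exact indep_of_indep_of_le_left hind hpair.comap_le
  have hpm : Measurable fun ω => (Z ω, ξ ω) := hpair.mono hm le_rfl
  have hmap := (indepFun_iff_map_prod_eq_prod_map_map hpm.aemeasurable hD.aemeasurable).1 hif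
  rw [hD.map_eq] at hmap
  have hf : Measurable fun x : (ℝ≥0∞ × ℝ) × ℝ =>
      x.1.1 * ENNReal.ofReal (Real.exp (x.1.2 * x.2 - x.1.2 ^ 2 * v / 2)) := by fun_prop
  calc _ = ∫⁻ x, x.1.1 * ENNReal.ofReal (Real.exp (x.1.2 * x.2 - x.1.2 ^ 2 * v / 2))
        ∂(P.map fun ω => ((Z ω, ξ ω), D ω)) :=
        (lintegral_map' hf.aemeasurable (hpm.aemeasurable.prodMk hD.aemeasurable)).symm
    _ = ∫⁻ y, ∫⁻ d, y.1 * ENNReal.ofReal (Real.exp (y.2 * d - y.2 ^ 2 * v / 2))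
        ∂(gaussianReal 0 v) ∂(P.map fun ω => (Z ω, ξ ω)) := by
        rw [hmap, lintegral_prod _ hf.aemeasurable]
    _ = ∫⁻ y, y.1 ∂(P.map fun ω => (Z ω, ξ ω)) := by
        refine lintegral_congr fun y => ?_
        have hsplit : ∀ d : ℝ, ENNReal.ofReal (Real.exp (y.2 * d - y.2 ^ 2 * v / 2)) =
            ENNReal.ofReal (Real.exp (-(y.2 ^ 2 * v / 2))) *
              ENNReal.ofReal (Real.exp (y.2 * d)) := by
          intro d
          rw [← ENNReal.ofReal_mul (Real.exp_pos _).le, ← Real.exp_add]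
          congr 2
          ring
        rw [lintegral_const_mul _ (by fun_prop)]
        simp only [hsplit]
        rw [lintegral_const_mul _ (by fun_prop), lintegral_exp_mul_gaussianReal,
          ← ENNReal.ofReal_mul (Real.exp_pos _).le, ← Real.exp_add]
        rw [show -(y.2 ^ 2 * v / 2) + v * y.2 ^ 2 / 2 = 0 by ring]
        simp
    _ = ∫⁻ ω, Z ω ∂P := lintegral_map measurable_fst hpm

section Ito

variable {Ω : Type*} [mΩ : MeasurableSpace Ω] {P : Measure Ω}

variable {𝓕 : Filtration ℝ mΩ} {W : ℝ → Ω → ℝ}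

/-- This is the exponential martingale: conditioning on the past at the last partition time removes
the last factor, and induction does the rest. -/
theorem SimpleProcess.lintegral_exp_integral_eq_one [IsProbabilityMeasure P]
    (hW : IsBrownianMotion P 𝓕 W) (H : SimpleProcess 𝓕) (r : ℝ) :
    ∫⁻ ω, ENNReal.ofReal (Real.exp (r * H.integral W ω - r ^ 2 / 2 *
      ∑ j ∈ Finset.range H.n, H.coeff j ω ^ 2 * (H.time (j + 1) - H.time j))) ∂P = 1 := by
  have key : ∀ n : ℕ, ∫⁻ ω, ENNReal.ofReal (Real.exp (∑ j ∈ Finset.range n,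
      (r * H.coeff j ω * (W (H.time (j + 1)) ω - W (H.time j) ω) -
        (r * H.coeff j ω) ^ 2 * (H.time (j + 1) - H.time j).toNNReal / 2))) ∂P = 1 := by
    intro n
    induction n with
    | zero => simp
    | succ n ih =>
      have hle : H.time n ≤ H.time (n + 1) := H.time_mono (Nat.le_succ n)
      have hZ : Measurable[𝓕 (H.time n)] fun ω => ENNReal.ofReal (Real.exp
          (∑ j ∈ Finset.range n, (r * H.coeff j ω * (W (H.time (j + 1)) ω - W (H.time j) ω) -
            (r * H.coeff j ω) ^ 2 * (H.time (j + 1) - H.time j).toNNReal / 2))) := by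
        refine Measurable.ennreal_ofReal
          (Real.measurable_exp.comp (Finset.measurable_fun_sum (Finset.range n) fun j hj => ?_))
        have hj : j + 1 ≤ n := Finset.mem_range.1 hj
        have hc : Measurable[𝓕 (H.time n)] (H.coeff j) :=
          (H.coeff_measurable j).mono (𝓕.mono (H.time_mono ((Nat.le_succ j).trans hj))) le_rfl
        have hw := hW.adapted (H.time j) (H.time (j + 1)) (H.time n)
          (H.time_mono (Nat.le_succ j)) (H.time_mono hj)
        exact ((hc.const_mul r).mul hw).sub
          ((((hc.const_mul r).pow_const 2).mul_const _).div_const _)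
      rw [← ih, ← lintegral_mul_exp_gaussian (𝓕.le (H.time n)) hZ
        ((H.coeff_measurable n).const_mul r) (hW.law _ _ hle) (hW.indep _ _ hle)]
      refine lintegral_congr fun ω => ?_
      rw [Finset.sum_range_succ, Real.exp_add, ENNReal.ofReal_mul (Real.exp_pos _).le]
  rw [← key H.n]
  refine lintegral_congr fun ω => ?_
  congr 2
  rw [SimpleProcess.integral, Finset.mul_sum, Finset.mul_sum, ← Finset.sum_sub_distrib]
  refine Finset.sum_congr rfl fun j _ => ?_
  rw [Real.coe_toNNReal _ (sub_nonneg.2 (H.time_mono (Nat.le_succ j)))]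
  ring

theorem SimpleProcess.sum_sq_le_lintegral (H : SimpleProcess 𝓕) (ω : Ω) :
    ENNReal.ofReal (∑ j ∈ Finset.range H.n, H.coeff j ω ^ 2 * (H.time (j + 1) - H.time j)) ≤
      ∫⁻ s, ‖H.val s ω‖ₑ ^ 2 := by
  have hpt : ∀ s, ∑ j ∈ Finset.range H.n, (Ioc (H.time j) (H.time (j + 1))).indicator
      (fun _ => ‖H.coeff j ω‖ₑ ^ 2) s ≤ ‖H.val s ω‖ₑ ^ 2 := by
    intro s
    by_cases hs : ∃ i < H.n, s ∈ Ioc (H.time i) (H.time (i + 1))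
    · obtain ⟨i, hi, hs⟩ := hs
      rw [SimpleProcess.val, sum_indicator_Ioc H.time_mono hi (fun j => H.coeff j ω) hs,
        Finset.sum_eq_single i, indicator_of_mem hs]
      · intro j _ hij
        refine indicator_of_notMem (fun hj => ?_) _
        exact Set.disjoint_left.1 (H.time_mono.pairwise_disjoint_on_Ioc_succ hij) hj hs
      · intro h
        exact absurd (Finset.mem_range.2 hi) h
    · push Not at hs
      rw [Finset.sum_eq_zero fun i hi => indicator_of_notMem (hs i (Finset.mem_range.1 hi)) _]
      exact zero_le
  refine le_trans (le_of_eq ?_) (lintegral_mono hpt)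
  rw [lintegral_finsetSum _ fun j _ => measurable_const.indicator measurableSet_Ioc,
    ENNReal.ofReal_sum_of_nonneg fun j _ =>
      mul_nonneg (sq_nonneg _) (sub_nonneg.2 (H.time_mono (Nat.le_succ j)))]
  refine Finset.sum_congr rfl fun j _ => ?_
  rw [lintegral_indicator measurableSet_Ioc, setLIntegral_const, Real.volume_Ioc,
    ENNReal.ofReal_mul (sq_nonneg _), ← sq_abs, ENNReal.ofReal_pow (abs_nonneg _),
    Real.enorm_eq_ofReal_abs]

theorem enorm_sub_sq_le (a b : ℝ) : ‖a - b‖ₑ ^ 2 ≤ 2 * ‖a‖ₑ ^ 2 + 2 * ‖b‖ₑ ^ 2 := by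
  simp only [Real.enorm_eq_ofReal_abs]
  rw [← ENNReal.ofReal_pow (abs_nonneg _), ← ENNReal.ofReal_pow (abs_nonneg _),
    ← ENNReal.ofReal_pow (abs_nonneg _), show (2 : ℝ≥0∞) = ENNReal.ofReal 2 by simp,
    ← ENNReal.ofReal_mul (by norm_num), ← ENNReal.ofReal_mul (by norm_num),
    ← ENNReal.ofReal_add (by positivity) (by positivity)]
  refine ENNReal.ofReal_le_ofReal ?_
  simp only [sq_abs]
  nlinarith [sq_nonneg (a + b)]

theorem SimpleProcess.measurable_val_time (H : SimpleProcess 𝓕) (ω : Ω) :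
    Measurable fun s => H.val s ω :=
  Finset.measurable_fun_sum _ fun _ _ => measurable_const.indicator measurableSet_Ioc

theorem lintegral_enorm_sub_sq_le {f g : ℝ → ℝ} (hf : Measurable f) :
    ∫⁻ s, ‖f s - g s‖ₑ ^ 2 ≤ 2 * (∫⁻ s, ‖f s‖ₑ ^ 2) + 2 * ∫⁻ s, ‖g s‖ₑ ^ 2 := by
  refine (lintegral_mono fun s => enorm_sub_sq_le (f s) (g s)).trans_eq ?_
  rw [lintegral_add_left (by fun_prop), lintegral_const_mul' _ _ (by norm_num),
    lintegral_const_mul' _ _ (by norm_num)]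

theorem IsItoIntegral.sub {H H' : ℝ → Ω → ℝ} {Y Y' : Ω → ℝ} (h : IsItoIntegral P 𝓕 W H Y)
    (h' : IsItoIntegral P 𝓕 W H' Y') (hH : ∀ ω, Measurable fun s => H s ω) :
    IsItoIntegral P 𝓕 W (fun s ω => H s ω - H' s ω) (fun ω => Y ω - Y' ω) := by
  obtain ⟨S, hS, hSI⟩ := h
  obtain ⟨S', hS', hSI'⟩ := h'
  choose R hRval hRint using fun n => (S n).exists_sub (S' n)
  refine ⟨R, fun ε hε => ?_, ?_⟩
  · have hε4 : 0 < ε / 4 := ENNReal.div_pos hε.ne' (by norm_num)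
    have hlim := (hS _ hε4).add (hS' _ hε4)
    rw [add_zero] at hlim
    refine tendsto_of_tendsto_of_tendsto_of_le_of_le tendsto_const_nhds hlim
      (fun _ => zero_le) fun n => ?_
    refine (measure_mono ?_).trans (measure_union_le _ _)
    intro ω hω
    by_contra hcon
    simp only [mem_union, mem_ofPred_eq, not_or, not_le] at hcon hω
    have hle : ∫⁻ s, ‖(R n).val s ω - (H s ω - H' s ω)‖ₑ ^ 2 ≤
        2 * (∫⁻ s, ‖(S n).val s ω - H s ω‖ₑ ^ 2) + 2 * ∫⁻ s, ‖(S' n).val s ω - H' s ω‖ₑ ^ 2 := by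
      refine le_trans (le_of_eq ?_) (lintegral_enorm_sub_sq_le
        (((S n).measurable_val_time ω).sub (hH ω)))
      refine lintegral_congr fun s => ?_
      rw [hRval, sub_sub_sub_comm]
    refine absurd (hω.trans hle) (not_le.2 ?_)
    have e : ε = 2 * (ε / 4) + 2 * (ε / 4) := by
      rw [← mul_add, ← two_mul, ← mul_assoc, show (2 : ℝ≥0∞) * 2 = 4 by norm_num,
        ENNReal.mul_div_cancel (by norm_num) (by norm_num)]
    conv_rhs => rw [e]
    refine ENNReal.add_lt_add ?_ ?_
    · exact (ENNReal.mul_lt_mul_iff_right (by norm_num) (by norm_num)).2 hcon.1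
    · exact (ENNReal.mul_lt_mul_iff_right (by norm_num) (by norm_num)).2 hcon.2
  · rw [tendstoInMeasure_iff_norm] at hSI hSI' ⊢
    intro ε hε
    have hlim := (hSI _ (half_pos hε)).add (hSI' _ (half_pos hε))
    rw [add_zero] at hlim
    refine tendsto_of_tendsto_of_tendsto_of_le_of_le tendsto_const_nhds hlim
      (fun _ => zero_le) fun n => ?_
    refine (measure_mono ?_).trans (measure_union_le _ _)
    intro ω hω
    by_contra hcon
    simp only [mem_union, mem_ofPred_eq, not_or, not_le] at hcon hω
    rw [hRint, sub_sub_sub_comm] at hω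
    linarith [norm_sub_le ((S n).integral W ω - Y ω) ((S' n).integral W ω - Y' ω), hcon.1, hcon.2]

/-- Fatou's lemma is applied to the exponential martingales of simple approximants, along a
subsequence where integrals and `L²` errors converge almost surely. Since these martingales have
expectation one over all of `Ω`, no stopping at level `K` is needed. -/
theorem IsItoIntegral.setLIntegral_exp_le [IsProbabilityMeasure P] (hW : IsBrownianMotion P 𝓕 W)
    {H : ℝ → Ω → ℝ} {Y : Ω → ℝ} (h : IsItoIntegral P 𝓕 W H Y)
    (hH : Measurable (Function.uncurry H)) {K : ℝ} (hK : 0 < K) (r : ℝ) :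
    ∫⁻ ω in {ω | ∫⁻ s, ‖H s ω‖ₑ ^ 2 ≤ ENNReal.ofReal K}, ENNReal.ofReal (Real.exp (r * Y ω)) ∂P ≤
      ENNReal.ofReal (Real.exp (2 * r ^ 2 * K)) := by
  obtain ⟨S, hS, hSI⟩ := h
  set e : ℕ → Ω → ℝ≥0∞ := fun n ω => ∫⁻ s, ‖(S n).val s ω - H s ω‖ₑ ^ 2 with he
  set A : Set Ω := {ω | ∫⁻ s, ‖H s ω‖ₑ ^ 2 ≤ ENNReal.ofReal K} with hA
  have hAm : MeasurableSet A := by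
    refine measurableSet_le ?_ measurable_const
    exact Measurable.lintegral_prod_left (f := fun s ω => ‖H s ω‖ₑ ^ 2)
      ((hH.enorm).pow_const 2)
  obtain ⟨ns, hns, hae⟩ := hSI.exists_seq_tendsto_ae
  -- The squared `L²` error may be infinite; truncating it at one makes it real-valued, so a
  -- subsequence can be extracted.
  have hd : TendstoInMeasure P (fun n ω => (min (e (ns n) ω) 1).toReal) atTop (fun _ => 0) := by
    rw [tendstoInMeasure_iff_norm]
    intro ε hε
    refine tendsto_of_tendsto_of_tendsto_of_le_of_le tendsto_const_nhds
      ((hS (ENNReal.ofReal ε) (ENNReal.ofReal_pos.2 hε)).comp hns.tendsto_atTop)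
      (fun _ => zero_le) fun n => measure_mono fun ω hω => ?_
    simp only [mem_ofPred_eq, sub_zero, Real.norm_eq_abs, ENNReal.abs_toReal] at hω ⊢
    exact (ENNReal.ofReal_le_of_le_toReal hω).trans (min_le_left _ _)
  obtain ⟨ns', hns', hae'⟩ := hd.exists_seq_tendsto_ae
  set I : ℕ → Ω → ℝ := fun n ω => (S (ns (ns' n))).integral W ω with hI
  set q : ℕ → Ω → ℝ := fun n ω => ∑ j ∈ Finset.range (S (ns (ns' n))).n,
    (S (ns (ns' n))).coeff j ω ^ 2 *
      ((S (ns (ns' n))).time (j + 1) - (S (ns (ns' n))).time j) with hq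
  have hcm : ∀ n j, Measurable ((S n).coeff j) := fun n j =>
    ((S n).coeff_measurable j).mono (𝓕.le _) le_rfl
  have hfm : ∀ n, Measurable fun ω => ENNReal.ofReal (Real.exp (r * I n ω - r ^ 2 / 2 * q n ω)) := by
    intro n
    refine Measurable.ennreal_ofReal (Real.measurable_exp.comp (Measurable.sub
      (Measurable.const_mul ?_ _) (Measurable.const_mul ?_ _)))
    · exact Finset.measurable_fun_sum _ fun j _ =>
        (hcm _ j).mul ((hW.measurable _).sub (hW.measurable _))
    · exact Finset.measurable_fun_sum _ fun j _ => ((hcm _ j).pow_const 2).mul_const _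
  have hpt : ∀ᵐ ω ∂(P.restrict A), ENNReal.ofReal (Real.exp (r * Y ω)) ≤
      ENNReal.ofReal (Real.exp (2 * r ^ 2 * K)) * liminf (fun n =>
        ENNReal.ofReal (Real.exp (r * I n ω - r ^ 2 / 2 * q n ω))) atTop := by
    filter_upwards [ae_restrict_mem hAm, ae_restrict_of_ae hae, ae_restrict_of_ae hae']
      with ω hω h1 h2
    have hIlim : Tendsto (fun n => I n ω) atTop (𝓝 (Y ω)) := h1.comp hns'.tendsto_atTop
    -- From `(a + b)² ≤ 2a² + 2b²` with both integrals at most `K`; the constant `2 r² K` is `r² /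
    -- 2` times this `4 K`.
    have hqle : ∀ᶠ n in atTop, q n ω ≤ 4 * K := by
      have hmin : 0 < min K 1 := by positivity
      filter_upwards [h2.eventually_lt_const hmin] with n hn
      have h3 : min (e (ns (ns' n)) ω) 1 < ENNReal.ofReal (min K 1) :=
        (ENNReal.lt_ofReal_iff_toReal_lt (by simp)).2 hn
      have h4 : e (ns (ns' n)) ω ≤ ENNReal.ofReal K := by
        rcases min_lt_iff.1 h3 with h | h
        · exact h.le.trans (ENNReal.ofReal_le_ofReal (min_le_left _ _))
        · exfalso
          refine absurd h (not_lt.2 ?_)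
          rw [← ENNReal.ofReal_one]
          exact ENNReal.ofReal_le_ofReal (min_le_right _ _)
      have h5 : ENNReal.ofReal (q n ω) ≤ ENNReal.ofReal (4 * K) := by
        calc ENNReal.ofReal (q n ω) ≤ ∫⁻ s, ‖(S (ns (ns' n))).val s ω‖ₑ ^ 2 :=
              (S (ns (ns' n))).sum_sq_le_lintegral ω
          _ = ∫⁻ s, ‖((S (ns (ns' n))).val s ω - H s ω) - -H s ω‖ₑ ^ 2 := by simp
          _ ≤ 2 * (∫⁻ s, ‖(S (ns (ns' n))).val s ω - H s ω‖ₑ ^ 2) +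
              2 * ∫⁻ s, ‖-H s ω‖ₑ ^ 2 :=
              lintegral_enorm_sub_sq_le (((S (ns (ns' n))).measurable_val_time ω).sub
                (hH.comp measurable_prodMk_right))
          _ ≤ 2 * ENNReal.ofReal K + 2 * ENNReal.ofReal K := by
              simp only [enorm_neg]
              gcongr
              exact hω
          _ = ENNReal.ofReal (4 * K) := by
              rw [← two_mul, ← mul_assoc, ENNReal.ofReal_mul (by norm_num)]
              norm_num
      exact (ENNReal.ofReal_le_ofReal_iff (by positivity)).1 h5
    have hlim : Tendsto (fun n => ENNReal.ofReal (Real.exp (r * I n ω - 2 * r ^ 2 * K))) atTop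
        (𝓝 (ENNReal.ofReal (Real.exp (r * Y ω - 2 * r ^ 2 * K)))) :=
      ENNReal.tendsto_ofReal ((Real.continuous_exp.tendsto _).comp
        ((hIlim.const_mul r).sub_const _))
    have hle : ENNReal.ofReal (Real.exp (r * Y ω - 2 * r ^ 2 * K)) ≤ liminf (fun n =>
        ENNReal.ofReal (Real.exp (r * I n ω - r ^ 2 / 2 * q n ω))) atTop := by
      rw [← hlim.liminf_eq]
      refine liminf_le_liminf ?_
      filter_upwards [hqle] with n hn
      refine ENNReal.ofReal_le_ofReal (Real.exp_le_exp.2 ?_)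
      nlinarith [sq_nonneg r]
    refine le_trans (le_of_eq ?_) (mul_le_mul_right hle _)
    rw [← ENNReal.ofReal_mul (Real.exp_pos _).le, ← Real.exp_add]
    congr 2
    ring
  calc _ ≤ ∫⁻ ω in A, ENNReal.ofReal (Real.exp (2 * r ^ 2 * K)) * liminf (fun n =>
        ENNReal.ofReal (Real.exp (r * I n ω - r ^ 2 / 2 * q n ω))) atTop ∂P := lintegral_mono_ae hpt
    _ ≤ ENNReal.ofReal (Real.exp (2 * r ^ 2 * K)) * ∫⁻ ω, liminf (fun n =>
        ENNReal.ofReal (Real.exp (r * I n ω - r ^ 2 / 2 * q n ω))) atTop ∂P := by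
        rw [lintegral_const_mul' _ _ ENNReal.ofReal_ne_top]
        gcongr
        exact Measure.restrict_le_self
    _ ≤ ENNReal.ofReal (Real.exp (2 * r ^ 2 * K)) * 1 := by
        gcongr
        refine (lintegral_liminf_le hfm).trans ?_
        simp only [hI, hq, SimpleProcess.lintegral_exp_integral_eq_one hW]
        simp
    _ = _ := mul_one _

end Ito

/-! ### Increments of kernels -/

/-- Translation is continuous in `L²(ℝ)`. -/
theorem tendsto_lintegral_enorm_translate_sub_sq {f : ℝ → ℝ} (hf : MemLp f 2) :
    Tendsto (fun h : ℝ => ∫⁻ x, ‖f (x + h) - f x‖ₑ ^ 2) (𝓝 0) (𝓝 0) := by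
  have : Fact ((2 : ℝ≥0∞) ≠ ∞) := ⟨by norm_num⟩
  have hc : Continuous fun h : ℝ => edist (DomAddAct.mk h +ᵥ hf.toLp f) (hf.toLp f) :=
    ((DomAddAct.continuous_mk.vadd continuous_const).edist continuous_const)
  have hlim := hc.tendsto 0
  have h0 : DomAddAct.mk (0 : ℝ) +ᵥ hf.toLp f = hf.toLp f := zero_vadd _ _
  rw [h0, edist_self] at hlim
  have hsq : Tendsto (fun h : ℝ => (edist (DomAddAct.mk h +ᵥ hf.toLp f) (hf.toLp f)) ^ 2)
      (𝓝 0) (𝓝 0) := by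
    have := ((ENNReal.continuous_pow 2).tendsto 0).comp hlim
    simpa using! this
  refine hsq.congr fun h => ?_
  rw [DomAddAct.mk_vadd_toLp, Lp.edist_toLp_toLp,
    eLpNorm_eq_lintegral_rpow_enorm_toReal (by norm_num) (by norm_num)]
  simp only [ENNReal.toReal_ofNat, ← ENNReal.rpow_natCast, ← ENNReal.rpow_mul]
  norm_num
  refine lintegral_congr fun x => ?_
  rw [add_comm]

/-- By Darboux's theorem a sign change forces a zero of `g'` in between; as `|g'|` is
non-increasing, `g'` vanishes from there on, which contradicts the sign at the larger of the two
points. -/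
theorem forall_nonneg_or_forall_nonpos_of_antitoneOn_abs {g g' : ℝ → ℝ} {a : ℝ}
    (hd : ∀ x, a < x → HasDerivAt g (g' x) x) (ha : AntitoneOn (fun x => |g' x|) (Ioi a)) :
    (∀ x, a < x → 0 ≤ g' x) ∨ ∀ x, a < x → g' x ≤ 0 := by
  by_contra hcon
  push Not at hcon
  obtain ⟨⟨x, hx, hx0⟩, y, hy, hy0⟩ := hcon
  have hconv : OrdConnected (g' '' uIcc x y) :=
    ordConnected_uIcc.image_hasDerivWithinAt fun z hz =>
      (hd z (lt_of_lt_of_le (lt_min hx hy) hz.1)).hasDerivWithinAt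
  obtain ⟨z, hz, hz0⟩ := hconv.out (mem_image_of_mem _ left_mem_uIcc)
    (mem_image_of_mem _ right_mem_uIcc) ⟨hx0.le, hy0.le⟩
  have hza : a < z := lt_of_lt_of_le (lt_min hx hy) hz.1
  have key : ∀ w, a < w → z ≤ w → g' w = 0 := by
    intro w hw hzw
    have := ha hza hw hzw
    simpa [hz0] using this
  rcases le_total z x with h | h
  · exact hx0.ne (key x hx h)
  · have : z ≤ y := by
      have := hz.2
      rcases le_max_iff.1 this with h' | h'
      · obtain rfl : z = x := le_antisymm h' h
        exact absurd hz0 hx0.ne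
      · exact h'
    exact hy0.ne' (key y hy this)

/-- Here `g` is non-decreasing and `u ↦ g (u + h) - g u` is non-increasing, because `g'` is
nonnegative and non-increasing. -/
theorem abs_increment_le_of_antitoneOn {g g' : ℝ → ℝ} {a : ℝ}
    (hd : ∀ x, a < x → HasDerivAt g (g' x) x) (ha : AntitoneOn g' (Ioi a))
    (h0 : ∀ x, a < x → 0 ≤ g' x) {x y h h' : ℝ} (hx : a < x) (hxy : x ≤ y) (hh : 0 ≤ h)
    (hh' : h ≤ h') : |g (y + h) - g y| ≤ |g (x + h') - g x| := by
  have hmono : MonotoneOn g (Ioi a) := by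
    refine monotoneOn_of_deriv_nonneg (convex_Ioi a)
      (fun z hz => (hd z hz).continuousAt.continuousWithinAt) ?_ ?_
    · rw [interior_Ioi]
      exact fun z hz => (hd z hz).differentiableAt.differentiableWithinAt
    · rw [interior_Ioi]
      intro z hz
      rw [(hd z hz).deriv]
      exact h0 z hz
  have hder : ∀ z ∈ Ioi a, HasDerivAt (fun u => g (u + h) - g u) (g' (z + h) - g' z) z := by
    intro z hz
    have hz' : a < z + h := lt_add_of_lt_of_nonneg hz hh
    exact ((hd _ hz').comp_add_const z h).sub (hd z hz)
  have hanti : AntitoneOn (fun u => g (u + h) - g u) (Ioi a) := by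
    refine antitoneOn_of_deriv_nonpos (convex_Ioi a)
      (fun z hz => (hder z hz).continuousAt.continuousWithinAt) ?_ ?_
    · rw [interior_Ioi]
      exact fun z hz => (hder z hz).differentiableAt.differentiableWithinAt
    · rw [interior_Ioi]
      intro z hz
      rw [(hder z hz).deriv]
      have hz' : a < z + h := lt_add_of_lt_of_nonneg hz hh
      linarith [ha hz hz' (le_add_of_nonneg_right hh)]
  have hy : a < y := hx.trans_le hxy
  have h1 : g y ≤ g (y + h) :=
    hmono hy (lt_add_of_lt_of_nonneg hy hh) (le_add_of_nonneg_right hh)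
  have h2 : g (y + h) - g y ≤ g (x + h) - g x := hanti hx hy hxy
  have h3 : g (x + h) ≤ g (x + h') :=
    hmono (lt_add_of_lt_of_nonneg hx hh) (lt_add_of_lt_of_nonneg hx (hh.trans hh')) (by linarith)
  rw [abs_of_nonneg (by linarith), abs_of_nonneg (by linarith)]
  linarith

/-- If `|g'|` is non-increasing beyond `a`, the absolute increments of `g` beyond `a` decrease when
the interval is moved to the right or shortened. -/
theorem abs_increment_le {g g' : ℝ → ℝ} {a : ℝ} (hd : ∀ x, a < x → HasDerivAt g (g' x) x)
    (ha : AntitoneOn (fun x => |g' x|) (Ioi a)) {x y h h' : ℝ} (hx : a < x) (hxy : x ≤ y)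
    (hh : 0 ≤ h) (hh' : h ≤ h') : |g (y + h) - g y| ≤ |g (x + h') - g x| := by
  rcases forall_nonneg_or_forall_nonpos_of_antitoneOn_abs hd ha with h0 | h0
  · refine abs_increment_le_of_antitoneOn hd ?_ h0 hx hxy hh hh'
    intro u hu v hv huv
    have := ha hu hv huv
    simpa only [abs_of_nonneg (h0 u hu), abs_of_nonneg (h0 v hv)] using this
  · have := abs_increment_le_of_antitoneOn (g := fun x => -g x) (g' := fun x => -g' x)
      (fun x hx => (hd x hx).neg) ?_ (fun x hx => neg_nonneg.2 (h0 x hx)) hx hxy hh hh'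
    · simpa only [neg_sub_neg, abs_sub_comm] using this
    · intro u hu v hv huv
      have := ha hu hv huv
      simpa only [abs_of_nonpos (h0 u hu), abs_of_nonpos (h0 v hv)] using this

/-- Square integrability is at stake only near zero. There `ε` is half the gap between `α` and
`-1/2`, so that the exponent `2(α - ε)` of the bound on `g²` stays above `-1`. -/
theorem memLp_indicator_of_scaling {α : ℝ} (hα : -(1 / 2) < α) {g Lg : ℝ → ℝ}
    (hgc : ContinuousOn g (Ioi 0)) (hL : SlowlyVaryingAtZero Lg)
    (hg : ∀ x, 0 < x → g x = x ^ α * Lg x) (R : ℝ) : MemLp ((Ioo 0 R).indicator g) 2 := by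
  have hLc : ContinuousOn Lg (Ioi 0) := by
    have : ContinuousOn (fun x : ℝ => x ^ (-α) * g x) (Ioi 0) :=
      ContinuousOn.mul (fun x hx => (Real.continuousAt_rpow_const _ _
        (Or.inl (ne_of_gt hx))).continuousWithinAt) hgc
    refine this.congr fun x hx => ?_
    have hx : 0 < x := hx
    simp only
    rw [hg x hx, ← mul_assoc, ← Real.rpow_add hx, neg_add_cancel, Real.rpow_zero, one_mul]
  set ε := (α + 1 / 2) / 2 with hε
  have hε0 : 0 < ε := by rw [hε]; linarith
  obtain ⟨C, δ, hC, hδ, hb⟩ := hL.exists_bound hLc hε0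
  have hsq : ContinuousOn (fun x => g x ^ 2) (Ioi 0) := hgc.pow 2
  have h1 : IntegrableOn (fun x => g x ^ 2) (Ioo 0 δ) := by
    have hint : IntegrableOn (fun x : ℝ => C ^ 2 * x ^ (2 * (α - ε))) (Ioo 0 δ) :=
      ((intervalIntegral.integrableOn_Ioo_rpow_iff hδ).2 (by rw [hε]; linarith)).const_mul _
    refine Integrable.mono' hint
      ((hsq.mono Ioo_subset_Ioi_self).aestronglyMeasurable measurableSet_Ioo) ?_
    filter_upwards [ae_restrict_mem measurableSet_Ioo] with x hx
    have hx0 : 0 < x := hx.1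
    have hgx : |g x| ≤ C * x ^ (α - ε) := by
      rw [hg x hx0, abs_mul, abs_of_pos (Real.rpow_pos_of_pos hx0 _)]
      calc x ^ α * |Lg x| ≤ x ^ α * (C * x ^ (-ε)) :=
            mul_le_mul_of_nonneg_left (hb x ⟨hx0, hx.2.le⟩) (Real.rpow_pos_of_pos hx0 _).le
        _ = C * (x ^ α * x ^ (-ε)) := by ring
        _ = C * x ^ (α - ε) := by rw [← Real.rpow_add hx0, ← sub_eq_add_neg]
    rw [Real.norm_eq_abs, abs_pow]
    refine (pow_le_pow_left₀ (abs_nonneg _) hgx 2).trans_eq ?_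
    rw [mul_pow, ← Real.rpow_natCast (x ^ (α - ε)), ← Real.rpow_mul hx0.le]
    push_cast
    rw [mul_comm (α - ε)]
  have h2 : IntegrableOn (fun x => g x ^ 2) (Icc δ R) :=
    (hsq.mono fun x hx => lt_of_lt_of_le hδ hx.1).integrableOn_Icc
  have h3 : IntegrableOn (fun x => g x ^ 2) (Ioo 0 R) :=
    (h1.union h2).mono_set fun x hx => by
      rcases lt_or_ge x δ with h | h
      · exact Or.inl ⟨hx.1, h⟩
      · exact Or.inr ⟨h, hx.2.le⟩
  rw [memLp_indicator_iff_restrict measurableSet_Ioo]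
  exact (memLp_two_iff_integrable_sq
    ((hgc.mono Ioo_subset_Ioi_self).aestronglyMeasurable measurableSet_Ioo)).2 h3

/-- The integrand `s ↦ g (t - s) f s 1_{s < t}` of a moving average. -/
noncomputable def movingIntegrand (g f : ℝ → ℝ) (t s : ℝ) : ℝ :=
  (Iio t).indicator (fun s => g (t - s) * f s) s

/-- The integrands of a moving average are `L²`-equicontinuous on `[0, 1]`. -/
theorem eventually_lintegral_movingIntegrand_sub_sq_le {α : ℝ} (hα : -(1 / 2) < α)
    {g g' Lg f : ℝ → ℝ} {a : ℝ} (ha : 0 < a) (hgm : Measurable g) (hfm : Measurable f)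
    (hd : ∀ x, 0 < x → HasDerivAt g (g' x) x) (hL : SlowlyVaryingAtZero Lg)
    (hg : ∀ x, 0 < x → g x = x ^ α * Lg x) (hanti : AntitoneOn (fun x => |g' x|) (Ioi a))
    (hf : ∀ T : ℝ, ∃ M : ℝ, ∀ s ∈ Icc (-T) T, |f s| ≤ M)
    (h0 : ∫⁻ s, ‖movingIntegrand g f 0 s‖ₑ ^ 2 < ∞)
    (h1 : ∫⁻ s, ‖movingIntegrand g f 1 s‖ₑ ^ 2 < ∞) {K : ℝ} (hK : 0 < K) :
    ∀ᶠ h in 𝓝[>] (0 : ℝ), ∀ t ∈ Icc (0 : ℝ) 1,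
      ∫⁻ s, ‖movingIntegrand g f (t + h) s - movingIntegrand g f t s‖ₑ ^ 2 ≤
        ENNReal.ofReal K := by
  have hgc : ContinuousOn g (Ioi 0) := fun x hx => (hd x hx).continuousAt.continuousWithinAt
  have hd' : ∀ x, a < x → HasDerivAt g (g' x) x := fun x hx => hd x (ha.trans hx)
  -- For `s ≥ -a` and times below `2` the argument of `g` is below `a + 2`, so `G` may replace `g`;
  -- the contribution of these `s` is a translation error of `G` in `L²`.
  set G : ℝ → ℝ := (Ioo 0 (a + 3)).indicator g with hG
  have hGm : Measurable G := hgm.indicator measurableSet_Ioo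
  obtain ⟨M, hM⟩ := hf (a + 2)
  set D : ℝ → ℝ≥0∞ := fun h => ∫⁻ x, ‖G (x + h) - G x‖ₑ ^ 2 with hD
  -- For `s < -a`, monotonicity of increments bounds every `t ≥ 0` by the case `t = 0`, which makes
  -- the estimate uniform in `t`.
  set F : ℝ → ℝ≥0∞ := fun h => ∫⁻ s in Iio (-a), ‖(g (-s + h) - g (-s)) * f s‖ₑ ^ 2 with hF
  have hDlim : Tendsto D (𝓝[>] 0) (𝓝 0) :=
    (tendsto_lintegral_enorm_translate_sub_sq
      (memLp_indicator_of_scaling hα hgc hL hg (a + 3))).mono_left nhdsWithin_le_nhds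
  have hFlim : Tendsto F (𝓝[>] 0) (𝓝 0) := by
    -- Increments of length at most one are dominated by those of length one, which are differences
    -- of the integrands at times `1` and `0`.
    have hbound : ∫⁻ s in Iio (-a), ‖(g (-s + 1) - g (-s)) * f s‖ₑ ^ 2 ≠ ∞ := by
      refine ne_of_lt (lt_of_le_of_lt ?_ (ENNReal.add_lt_top.2
        ⟨ENNReal.mul_lt_top (by norm_num : (2 : ℝ≥0∞) < ∞) h1,
          ENNReal.mul_lt_top (by norm_num : (2 : ℝ≥0∞) < ∞) h0⟩))
      refine le_trans ?_ (lintegral_enorm_sub_sq_le ?_)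
      · rw [← lintegral_indicator measurableSet_Iio]
        refine lintegral_mono fun s => ?_
        by_cases hs : s ∈ Iio (-a)
        · have hs' : s < -a := hs
          rw [indicator_of_mem hs, movingIntegrand, movingIntegrand,
            indicator_of_mem (show s ∈ Iio (1 : ℝ) by simp only [mem_Iio]; linarith),
            indicator_of_mem (show s ∈ Iio (0 : ℝ) by simp only [mem_Iio]; linarith),
            ← sub_mul, zero_sub, show -s + 1 = 1 - s by ring]
        · rw [indicator_of_notMem hs]
          exact zero_le
      · exact ((hgm.comp (measurable_const.sub measurable_id)).mul hfm).indicator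
          measurableSet_Iio
    have := tendsto_lintegral_filter_of_dominated_convergence
      (μ := volume.restrict (Iio (-a))) (l := 𝓝[>] (0 : ℝ))
      (F := fun h s => ‖(g (-s + h) - g (-s)) * f s‖ₑ ^ 2) (f := fun _ => 0)
      (fun s => ‖(g (-s + 1) - g (-s)) * f s‖ₑ ^ 2) ?_ ?_ hbound ?_
    · rwa [lintegral_zero] at this
    · exact Eventually.of_forall fun h => by fun_prop
    · filter_upwards [Ioc_mem_nhdsGT (zero_lt_one (α := ℝ))] with h hh
      filter_upwards [ae_restrict_mem measurableSet_Iio] with s hs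
      have hs : a < -s := by linarith [show s < -a from hs]
      simp only [enorm_mul]
      gcongr
      rw [enorm_le_iff_norm_le]
      exact abs_increment_le hd' hanti hs le_rfl hh.1.le hh.2
    · filter_upwards [ae_restrict_mem measurableSet_Iio] with s hs
      have hs : 0 < -s := by linarith [show s < -a from hs]
      have hca : ContinuousAt (fun h => ‖(g (-s + h) - g (-s)) * f s‖ₑ ^ 2) 0 := by
        have hc1 : ContinuousAt (fun h => g (-s + h)) 0 := by
          refine ContinuousAt.comp (f := fun h => -s + h) (x := (0 : ℝ)) ?_ (by fun_prop)
          rw [add_zero]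
          exact (hd (-s) hs).continuousAt
        exact (ENNReal.continuous_pow 2).continuousAt.comp
          (((hc1.sub continuousAt_const).mul continuousAt_const).enorm)
      have := hca.tendsto
      simp only [add_zero, sub_self, zero_mul, enorm_zero, ne_eq, OfNat.ofNat_ne_zero,
        not_false_eq_true, zero_pow] at this
      exact this.mono_left nhdsWithin_le_nhds
  have hsum : Tendsto (fun h => ‖M‖ₑ ^ 2 * D h + F h) (𝓝[>] 0) (𝓝 0) := by
    have := (ENNReal.Tendsto.const_mul hDlim
      (Or.inr (by simp : ‖M‖ₑ ^ 2 ≠ ∞))).add hFlim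
    simpa using this
  filter_upwards [hsum.eventually_le_const (ENNReal.ofReal_pos.2 hK),
    Ioo_mem_nhdsGT (zero_lt_one (α := ℝ))] with h hle hh t ht
  refine le_trans ?_ hle
  have hpt : ∀ s, ‖movingIntegrand g f (t + h) s - movingIntegrand g f t s‖ₑ ^ 2 ≤
      ‖M‖ₑ ^ 2 * ‖G (t - s + h) - G (t - s)‖ₑ ^ 2 +
        (Iio (-a)).indicator (fun s => ‖(g (-s + h) - g (-s)) * f s‖ₑ ^ 2) s := by
    intro s
    rcases lt_or_ge s (-a) with hs | hs
    · refine le_trans ?_ le_add_self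
      rw [indicator_of_mem (show s ∈ Iio (-a) from hs), movingIntegrand, movingIntegrand,
        indicator_of_mem (show s ∈ Iio (t + h) by simp only [mem_Iio]; linarith [ht.1, hh.1]),
        indicator_of_mem (show s ∈ Iio t by simp only [mem_Iio]; linarith [ht.1]), ← sub_mul,
        show t + h - s = t - s + h by ring]
      simp only [enorm_mul]
      gcongr
      rw [enorm_le_iff_norm_le]
      exact abs_increment_le hd' hanti (by linarith) (by linarith [ht.1]) hh.1.le le_rfl
    · refine le_trans ?_ le_self_add
      have hmov : ∀ t' < 2, movingIntegrand g f t' s = G (t' - s) * f s := by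
        intro t' ht'
        rw [movingIntegrand, hG]
        by_cases hst : s < t'
        · rw [indicator_of_mem (show s ∈ Iio t' from hst),
            indicator_of_mem (show t' - s ∈ Ioo 0 (a + 3) from ⟨by linarith, by linarith⟩)]
        · rw [indicator_of_notMem (show s ∉ Iio t' from hst),
            indicator_of_notMem (fun hmem => hst (by linarith [hmem.1])), zero_mul]
      rw [hmov t (by linarith [ht.2]), hmov (t + h) (by linarith [ht.2, hh.2]), ← sub_mul,
        show t + h - s = t - s + h by ring, enorm_mul, mul_pow, mul_comm]
      -- The bound `M` on `f` covers `s < 2`; for `s ≥ 2` both values of `G` vanish because `t + h <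
      -- 2`.
      rcases lt_or_ge s 2 with hs2 | hs2
      · gcongr
        rw [enorm_le_iff_norm_le, Real.norm_eq_abs, Real.norm_eq_abs]
        exact (hM s ⟨by linarith, by linarith⟩).trans (le_abs_self M)
      · have e1 : G (t - s + h) = 0 :=
          indicator_of_notMem (fun hmem => by linarith [hmem.1, ht.2, hh.2]) _
        have e2 : G (t - s) = 0 :=
          indicator_of_notMem (fun hmem => by linarith [hmem.1, ht.2]) _
        simp [e1, e2]
  refine (lintegral_mono hpt).trans_eq ?_
  rw [lintegral_add_left (by fun_prop), lintegral_const_mul _ (by fun_prop),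
    lintegral_indicator measurableSet_Iio,
    lintegral_sub_left_eq_self (fun x => ‖G (x + h) - G x‖ₑ ^ 2) t]

/-! ### Brownian semistationary processes -/

theorem IsBSS.tendstoInMeasure_empVariogram {Ω : Type*} [mΩ : MeasurableSpace Ω] {P : Measure Ω}
    [IsProbabilityMeasure P] {α : ℝ} (hα : -(1 / 2) < α) {X : ℝ≥0 → Ω → ℝ}
    (hXm : ∀ t, AEMeasurable (X t) P) (hX : IsBSS P α X) {p : ℝ} (hp : 0 < p) {k : ℕ}
    (hk : 0 < k) :
    TendstoInMeasure P (fun n ω => empVariogram p n k (fun j => X ((j : ℝ≥0) / n) ω)) atTop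
      (fun _ => 0) := by
  obtain ⟨𝓕, W, σ, g, hW, -, hσm, -, hσb, hg, hfin, hito, -⟩ := hX
  obtain ⟨Lg, hLg, hgL⟩ := hg.scaling
  obtain ⟨g', -, hd, -, -, -, ⟨a, ha, hanti⟩, -⟩ := hg.deriv
  have hgm := hg.measurable
  have hito' : ∀ t : ℝ≥0,
      IsItoIntegral P 𝓕 W (fun s ω => movingIntegrand g (fun s => σ s ω) t s) (X t) := hito
  have hmm : ∀ t : ℝ, Measurable
      (Function.uncurry fun s ω => movingIntegrand g (fun s => σ s ω) t s) := by
    intro t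
    have h1 : Measurable fun q : ℝ × Ω => g (t - q.1) * σ q.1 q.2 :=
      (hgm.comp (measurable_const.sub measurable_fst)).mul hσm
    exact h1.indicator (measurableSet_Iio.preimage measurable_fst)
  have hfin' : ∀ t : ℝ≥0, ∀ᵐ ω ∂P,
      ∫⁻ s, ‖movingIntegrand g (fun s => σ s ω) t s‖ₑ ^ 2 < ∞ := by
    intro t
    filter_upwards [hfin t] with ω hω
    rw [← lintegral_indicator measurableSet_Iio] at hω
    refine lt_of_le_of_lt (lintegral_mono fun s => ?_) hω
    rw [movingIntegrand]
    by_cases hs : s ∈ Iio (t : ℝ)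
    · rw [indicator_of_mem hs, indicator_of_mem hs]
    · rw [indicator_of_notMem hs]
      simp
  set Q : ℕ → ℕ → Ω → ℝ≥0∞ := fun n i ω =>
    ∫⁻ s, ‖movingIntegrand g (fun s => σ s ω) ((((i + k : ℕ) : ℝ≥0) / n : ℝ≥0) : ℝ) s -
      movingIntegrand g (fun s => σ s ω) (((i : ℝ≥0) / n : ℝ≥0) : ℝ) s‖ₑ ^ 2 with hQ
  have hQm : ∀ n i, Measurable (Q n i) := fun n i =>
    Measurable.lintegral_prod_left (f := fun s ω =>
      ‖movingIntegrand g (fun s => σ s ω) ((((i + k : ℕ) : ℝ≥0) / n : ℝ≥0) : ℝ) s -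
      movingIntegrand g (fun s => σ s ω) (((i : ℝ≥0) / n : ℝ≥0) : ℝ) s‖ₑ ^ 2)
      (((hmm _).sub (hmm _)).enorm.pow_const 2)
  refine tendstoInMeasure_empVariogram_zero hp (fun n j => hXm _) hQm ?_ ?_
  · intro n i _ K hK r
    have hsub := (hito' (((i + k : ℕ) : ℝ≥0) / n)).sub (hito' ((i : ℝ≥0) / n))
      (fun ω => (hmm _).comp measurable_prodMk_right)
    exact hsub.setLIntegral_exp_le hW ((hmm _).sub (hmm _)) hK r
  · intro K hK
    set A : ℕ → Set Ω := fun n =>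
      {ω | ∃ i ∈ Finset.Icc 1 (n - k), ENNReal.ofReal K < Q n i ω} with hA
    have hAm : ∀ n, MeasurableSet (A n) := by
      intro n
      have : A n = ⋃ i ∈ Finset.Icc 1 (n - k), {ω | ENNReal.ofReal K < Q n i ω} := by
        ext ω
        simp [hA]
      rw [this]
      exact Finset.measurableSet_biUnion _ fun i _ => measurableSet_lt measurable_const (hQm n i)
    -- Almost every path eventually leaves `A n`, so the indicators tend to that of the empty set,
    -- and dominated convergence gives the tail condition.
    have hlim := tendsto_measure_of_ae_tendsto_indicator (μ := P) (L := atTop) (As := A)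
      MeasurableSet.empty hAm MeasurableSet.univ (measure_ne_top _ _)
      (Eventually.of_forall fun n => subset_univ _) ?_
    · rwa [measure_empty] at hlim
    filter_upwards [hσb, hfin' 0, hfin' 1] with ω hb h0 h1
    have hev := eventually_lintegral_movingIntegrand_sub_sq_le hα ha hgm
      (f := fun s => σ s ω) (hσm.comp measurable_prodMk_right) hd hLg hgL hanti hb h0 h1 hK
    filter_upwards [(tendsto_const_natCast_div hk).eventually hev, eventually_gt_atTop k]
      with n hn hnk
    have hn0 : (0 : ℝ) < n := by exact_mod_cast (Nat.zero_le k).trans_lt hnk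
    refine ⟨?_, fun h => absurd h (notMem_empty ω)⟩
    rintro ⟨i, hi, hlt⟩
    exfalso
    refine absurd hlt (not_lt.2 ?_)
    have hi' : i ≤ n := by simp only [Finset.mem_Icc] at hi; omega
    have := hn ((i : ℝ) / n) ⟨by positivity, by
      rw [div_le_one hn0]; exact_mod_cast hi'⟩
    simp only [hQ]
    rw [coe_add_div_eq]
    push_cast
    exact this

/-! ### The three models combined, and the limit of the estimator -/

theorem LLN.tendstoInMeasure_empVariogram {Ω : Type*} [mΩ : MeasurableSpace Ω] {P : Measure Ω}
    [IsProbabilityMeasure P] {X : ℝ≥0 → Ω → ℝ} (hXm : ∀ t, AEMeasurable (X t) P) (hX : LLN P X)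
    {p : ℝ} (hp : 0 < p) {k : ℕ} (hk : 0 < k) :
    TendstoInMeasure P (fun n ω => empVariogram p n k (fun j => X ((j : ℝ≥0) / n) ω)) atTop
      (fun _ => 0) := by
  obtain ⟨α, hα, h | h | h⟩ := hX
  · exact h.tendstoInMeasure_empVariogram hp hk
  · exact h.tendstoInMeasure_empVariogram hXm hp hk
  · exact h.tendstoInMeasure_empVariogram hα.1 hXm hp hk

end FractalIndex

theorem proposition4 {Ω : Type*} [MeasurableSpace Ω] (P : Measure Ω) [IsProbabilityMeasure P]
    -- the underlying process
    (X : ℝ≥0 → Ω → ℝ) (hXm : ∀ t, AEMeasurable (X t) P) (hX : FractalIndex.LLN P X)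
    -- the noise: for each `n`, the variables `u n 1, …, u n n` are iid `N(0, σu2)`
    (σu2 : ℝ≥0) (hσ : 0 < σu2) (u : ℕ → ℕ → Ω → ℝ)
    (hu_law : ∀ n, ∀ j ∈ Finset.Icc 1 n, HasLaw (u n j) (gaussianReal 0 σu2) P)
    (hu_indep : ∀ n, iIndepFun (fun j : Finset.Icc 1 n => u n j) P)
    -- the observations `Z n j = Z_{j/n}`, `j = 1, …, n`
    (c : ℝ) (Z : ℕ → ℕ → Ω → ℝ)
    (hZ : ∀ n, ∀ j ∈ Finset.Icc 1 n, ∀ ω, Z n j ω = c + X ((j : ℝ≥0) / n) ω + u n j ω)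
    (p : ℝ) (hp : 0 < p) (m : ℕ) (hm : 2 ≤ m) :
    TendstoInMeasure P (fun n ω => FractalIndex.olsIndex p m n (fun j => Z n j ω)) atTop
      (fun _ => -(1 / 2)) := by
  have hv : σu2 + σu2 ≠ 0 := (add_pos hσ hσ).ne'
  refine FractalIndex.tendstoInMeasure_olsIndex hp (by omega)
    (FractalIndex.integral_abs_rpow_gaussianReal_pos hp hv) fun k hk => ?_
  have hk0 : 0 < k := (Finset.mem_Icc.1 hk).1
  exact FractalIndex.tendstoInMeasure_empVariogram_add hp hZ
    (hX.tendstoInMeasure_empVariogram hXm hp hk0)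
    (FractalIndex.tendstoInMeasure_empVariogram_noise hu_law hu_indep hp hk0)
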